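/- **Setting.** An instance $\sigma$ consists of $N$ agents and $m$ alternatives; every agent ranks all alternatives strictly. A (pseudo)metric $d$ on the disjoint union of agents and alternatives is consistent with $\sigma$ if $d(v,c)\le d(v,c')$ whenever agent $v$ prefers $c$ to $c'$. For $1\le k\le N$ let $\phi_k(c,d)$ be the sum of the $k$ largest of the costs $d(v,c)$ over the agents $v$, and put $$\mathrm{fairness}(c,\sigma)=\sup_{d}\ \max_{1\le k\le N}\ \frac{\phi_k(c,d)}{\min_{c'}\phi_k(c',d)}\in[0,\infty],$$ the supremum being over all metrics $d$ consistent with $\sigma$ (with $x/0=\infty$ for $x>0$, $0/0=0$). The fairness ratio of a rule $f$ on a class of instances is $\sup_\sigma \mathrm{fairness}(f(\sigma),\sigma)$. For a vector $s\in\mathbb R^m$, the scoring rule of $s$ gives an alternative $s_i$ points for each agent who ranks it in position $i$, and selects an alternative with the highest total: $s=(1,\dots,1,0,\dots,0)$ with $\min(k,m)$ ones for $k$-Approval, $s=(1,\dots,1,0)$ for Veto, $s=(1,0,\dots,0)$ for Plurality (so Plurality is $1$-Approval), $s=(m-1,m-2,\dots,0)$ for Borda, $s=(1,\tfrac12,\dots,\tfrac1m)$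 for the harmonic rule. STV repeatedly eliminates an alternative ranked first, among the remaining ones, by the fewest agents; the last remaining alternative wins. Ties may be broken in any way, except where item 1 says otherwise. **Theorem.** There are positive absolute constants for which the following bounds hold. 1. On the instances with $N\ge1$ agents and $m$ alternatives, the fairness ratio of $k$-Approval and of Veto is $\Theta(N)$. Precisely: the lower bound $\Omega(N)$ holds for $k$-Approval whenever $1\le k<m$ and, if $k=1$, also $N\le m$, and for Veto whenever $m\ge3$; the upper bound $O(N)$ holds for all $k$ and $m$, provided that ties are broken so that the winner is never ranked below one and the same other alternative by all agents. 2. On the instances with $m\ge1$ alternatives and any number of agents, the fairness ratio of Plurality and of Borda is $\Theta(m)$. 3. On the instances with $m\ge2$ alternatives and any number of agents, the fairness ratio of the harmonic rule is $O(m/\sqrt{\log m})$ and $\Omega(m/\log m)$. 4. On the instances with $m\ge2$ alternatives and any number of agents, the fairness ratio of every scoring rule whose vector $s$ is not constant is $\Omega(\sqrt{\log m})$, with a constant that does not depend on $s$. 5. On the instances with $m\ge2$ alternatives and any number of agents, the fairness ratio of STV is $O(\log m)$ and $\Omega(\sqrt{\log m})$. -/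

import Mathlib

open scoped NNReal ENNReal

namespace SocialChoice

/-- An instance with `N` agents and `m` alternatives: each agent `v` has a strict ranking `σ v` of
the alternatives, encoded by the position of every alternative (position `0` is the top). -/
abbrev Profile (N m : ℕ) : Type := Fin N → (Fin m ≃ Fin m)

/-- Agent `v` prefers `c` over `c'`. -/
def Prefers {N m : ℕ} (σ : Profile N m) (v : Fin N) (c c' : Fin m) : Prop :=
  σ v c < σ v c'

/-- A function `d` with nonnegative values is a metric on `X`
(distinct points are allowed to be at distance `0`). -/
structure IsMetric {X : Type} (d : X → X → ℝ≥0) : Prop where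
  self : ∀ x, d x x = 0
  symm : ∀ x y, d x y = d y x
  triangle : ∀ x y z, d x z ≤ d x y + d y z

/-- Distance functions on the disjoint union of the agents and the alternatives. -/
abbrev DistFun (N m : ℕ) : Type := Fin N ⊕ Fin m → Fin N ⊕ Fin m → ℝ≥0

/-- The cost of agent `v` for the alternative `c`. -/
def cost {N m : ℕ} (d : DistFun N m) (v : Fin N) (c : Fin m) : ℝ≥0 :=
  d (Sum.inl v) (Sum.inr c)

/-- The set `ρ(σ)` of all metrics that are consistent with the instance `σ`. -/
def consistentMetrics {N m : ℕ} (σ : Profile N m) : Set (DistFun N m) :=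
  {d | IsMetric d ∧ ∀ v c c', Prefers σ v c c' → cost d v c ≤ cost d v c'}

/-- `φ_k(c, d)`: the sum of the `k` largest agent costs for `c`, that is, the maximum over all
sets of `k` agents of their total cost for `c`. -/
def topCost {N m : ℕ} (k : ℕ) (c : Fin m) (d : DistFun N m) : ℝ≥0 :=
  (Finset.powersetCard k (Finset.univ : Finset (Fin N))).sup fun A => ∑ v ∈ A, cost d v c

/-- `fairness(c, d)`: the maximum over `1 ≤ k ≤ N` of `φ_k(c, d) / min_{c'} φ_k(c', d)`, with values
in `[0, ∞]`, where `a / 0 = ∞` for `a > 0` and `0 / 0 = 0`. -/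
noncomputable def metricFairness {N m : ℕ} (c : Fin m) (d : DistFun N m) : ℝ≥0∞ :=
  ⨆ k ∈ Finset.Icc 1 N, (topCost k c d : ℝ≥0∞) / ⨅ c' : Fin m, (topCost k c' d : ℝ≥0∞)

/-- `fairness(c, σ)`: the worst case over all consistent metrics. -/
noncomputable def fairness {N m : ℕ} (c : Fin m) (σ : Profile N m) : ℝ≥0∞ :=
  ⨆ d ∈ consistentMetrics σ, metricFairness c d

/-- The fairness ratio of a social choice rule for `N` agents and `m` alternatives. -/
noncomputable def ruleFairness {N m : ℕ} (f : Profile N m → Fin m) : ℝ≥0∞ :=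
  ⨆ σ : Profile N m, fairness (f σ) σ

/-- The fairness ratio of a social choice rule for `m` alternatives: the worst case over all
instances with `m` alternatives and any number of agents. -/
noncomputable def totalFairness {m : ℕ} (f : ∀ N, Profile N m → Fin m) : ℝ≥0∞ :=
  ⨆ N : ℕ, ruleFairness (f N)

/-- The score of `c`: an agent who ranks `c` at position `i` gives it `s i` points. -/
def score {N m : ℕ} (s : Fin m → ℝ) (σ : Profile N m) (c : Fin m) : ℝ :=
  ∑ v, s (σ v c)

/-- `c` has the highest score with respect to the scoring vector `s` (possibly tied). -/
def IsScoringWinner {N m : ℕ} (s : Fin m → ℝ) (σ : Profile N m) (c : Fin m) : Prop :=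
  ∀ c', score s σ c' ≤ score s σ c

/-- `k`-Approval: one point for each of the first `k` positions. -/
def approvalVector (k m : ℕ) (i : Fin m) : ℝ := if (i : ℕ) < k then 1 else 0

/-- Veto: one point for each position except the last one. -/
def vetoVector (m : ℕ) (i : Fin m) : ℝ := if (i : ℕ) + 1 < m then 1 else 0

/-- Plurality: one point for the first position. -/
def pluralityVector (m : ℕ) (i : Fin m) : ℝ := if (i : ℕ) = 0 then 1 else 0

/-- Borda: `m - 1, m - 2, …, 0` points. -/
def bordaVector (m : ℕ) (i : Fin m) : ℝ := (m : ℝ) - 1 - ((i : ℕ) : ℝ)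

/-- The harmonic rule: `1, 1/2, …, 1/m` points. -/
noncomputable def harmonicVector (m : ℕ) (i : Fin m) : ℝ := 1 / (((i : ℕ) : ℝ) + 1)

/-- No alternative is preferred over `c` by every agent. -/
def Undominated {N m : ℕ} (σ : Profile N m) (c : Fin m) : Prop :=
  ¬ ∃ c', ∀ v, Prefers σ v c' c

open Classical in
/-- The number of agents whose favourite alternative among those in `S` is `c`. -/
noncomputable def firstCount {N m : ℕ} (σ : Profile N m) (S : Finset (Fin m)) (c : Fin m) : ℕ :=
  (Finset.univ.filter fun v : Fin N => ∀ c' ∈ S, c' ≠ c → Prefers σ v c c').card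

/-- `STVRemaining σ S`: repeatedly eliminating an alternative that is ranked first (among the
remaining ones) by the fewest agents, with some way of breaking ties, can lead to the set `S` of
remaining alternatives. -/
inductive STVRemaining {N m : ℕ} (σ : Profile N m) : Finset (Fin m) → Prop
  | start : STVRemaining σ Finset.univ
  | eliminate (S : Finset (Fin m)) (c : Fin m) (hS : STVRemaining σ S) (hcard : 1 < S.card)
      (hc : c ∈ S) (hmin : ∀ c' ∈ S, firstCount σ S c ≤ firstCount σ S c') :
      STVRemaining σ (S.erase c)

/-- `c` can be the last remaining alternative under STV. -/
def IsSTVWinner {N m : ℕ} (σ : Profile N m) (c : Fin m) : Prop :=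
  STVRemaining σ {c}

end SocialChoice

open SocialChoice

/-!
All bounds reduce to the sum of all costs (`k = N`). For the upper bounds, `φ_k(w)` is at most
`φ_k(o) + k d(w, o)`, and `φ_k(o) / k` is at least the average cost of `o`. So it suffices to bound
`N d(w, o)` by a multiple of `∑ v, d(v, o)` (`fairness_le`).

* If a fraction `1 / M` of the agents weakly prefers the winner `w` to `o`, these agents are at
  distance at least `d(w, o) / 2` from `o` (`fairness_le_of_card`). This gives the bounds for
  approval and veto (one such agent exists), plurality and Borda (a fraction `1 / m` exists).
* The other upper bounds look at the core of agents close to `o`. These rank a ball around `o`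
  above everything outside of a slightly larger ball (`lt_of_mem_core`). For the harmonic rule,
  a winner far away gets little from the core, but has at least the average score of each ball;
  applying this to two balls (`harmonic_mul_card_le`) bounds its distance. For STV, once a ball has
  been eliminated, at most about half as many alternatives survive in the next ball as did in the
  previous one (`four_mul_card_le`, `two_pow_le_of_chain`), so that the winner is found within
  about `log m` balls.

For the lower bounds, `hubMetric` realizes given costs by a metric. Placing a set `S` of
alternatives at distance `1` from all others, the agents who rank `S` at the top at `S`, and the
remaining agents halfway, makes every winner outside of `S` bad (`le_fairness_of_clusters`). For
scoring rules (`le_totalFairness_of_scores`), `S` is a block of `i` alternatives which most agents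
rank at the top, with its members rotated, and `w` is ranked next. In the few remaining rankings
`w` makes up for the difference between the average `a i` of the first `i` scores and the next
score. If this failed for every `i`, the averages would decrease by terms `(a 1 - a h) / (i + 1)`
times a constant, whose sum is too large since the harmonic series diverges. The bounds for Borda
and the harmonic rule come from particular choices of `i`. For STV, the alternatives form a tree
whose root wins because the levels are eliminated from the leaves upwards (`Hierarchy`), while
almost all agents sit close to an alternative `o` that is nobody's favourite.
-/

namespace SocialChoice

variable {N m : ℕ}

/-! ### Top costs and an upper bound for the fairness -/

lemma sum_le_topCost {A : Finset (Fin N)} {k : ℕ} (hA : A.card = k) (c : Fin m)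
    (d : DistFun N m) : ∑ v ∈ A, cost d v c ≤ topCost k c d :=
  Finset.le_sup (f := fun A => ∑ v ∈ A, cost d v c) (by simp [Finset.mem_powersetCard, hA])

lemma topCost_univ (c : Fin m) (d : DistFun N m) : topCost N c d = ∑ v, cost d v c := by
  have h : Finset.powersetCard N (Finset.univ : Finset (Fin N)) = {Finset.univ} := by
    simpa using Finset.powersetCard_self (Finset.univ : Finset (Fin N))
  simp [topCost, h]

/-- The average of the `k` largest costs is at least the average of all costs. -/
lemma mul_sum_cost_le_mul_topCost {k : ℕ} (hk : k ≤ N) (c : Fin m) (d : DistFun N m) :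
    (k : ℝ) * ∑ v, (cost d v c : ℝ) ≤ N * topCost k c d := by
  have hne : (Finset.powersetCard k (Finset.univ : Finset (Fin N))).Nonempty := by
    rw [Finset.powersetCard_nonempty]; simpa using hk
  obtain ⟨A, hA, hAeq⟩ := Finset.exists_mem_eq_sup _ hne (fun A => ∑ v ∈ A, cost d v c)
  have hcard : A.card = k := (Finset.mem_powersetCard.mp hA).2
  have htop : topCost k c d = ∑ v ∈ A, cost d v c := hAeq
  -- Exchanging an agent of a maximal set `A` for one outside of `A` does not increase the cost.
  have hswap : ∀ v ∈ A, ∀ u ∈ Aᶜ, (cost d u c : ℝ) ≤ cost d v c := by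
    intro v hv u hu
    have hu' : u ∉ A.erase v := fun h => (Finset.mem_compl.mp hu) (Finset.mem_of_mem_erase h)
    have h1 := sum_le_topCost (A := insert u (A.erase v)) (k := k) (by
      rw [Finset.card_insert_of_notMem hu', Finset.card_erase_of_mem hv, hcard]
      have : 0 < k := hcard ▸ Finset.card_pos.mpr ⟨v, hv⟩
      omega) c d
    rw [htop, Finset.sum_insert hu', ← Finset.add_sum_erase A _ hv] at h1
    exact_mod_cast le_of_add_le_add_right h1
  have h2 : (k : ℝ) * ∑ u ∈ Aᶜ, (cost d u c : ℝ) ≤ ((N : ℝ) - k) * ∑ v ∈ A, (cost d v c : ℝ) := by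
    have h3 : ∑ v ∈ A, ∑ u ∈ Aᶜ, (cost d u c : ℝ) ≤ ∑ v ∈ A, ∑ u ∈ Aᶜ, (cost d v c : ℝ) :=
      Finset.sum_le_sum fun v hv => Finset.sum_le_sum fun u hu => hswap v hv u hu
    simp only [Finset.sum_const, nsmul_eq_mul, ← Finset.mul_sum, Finset.card_compl,
      Fintype.card_fin, hcard, Nat.cast_sub hk] at h3
    exact h3
  rw [htop, ← Finset.sum_add_sum_compl A]
  push_cast
  linarith

/-- A bound for the distance of `w` to every other alternative in terms of the average cost of the
latter bounds the fairness, since `φ_k(w) ≤ φ_k(o) + k d(w, o)` and `φ_k(o) / k` is at least the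
average cost of `o`. -/
theorem fairness_le {σ : Profile N m} {w : Fin m} {C : ℝ} (hC : 0 ≤ C)
    (h : ∀ d ∈ consistentMetrics σ, ∀ o : Fin m,
      (N : ℝ) * d (Sum.inr w) (Sum.inr o) ≤ C * ∑ v, (cost d v o : ℝ)) :
    fairness w σ ≤ ENNReal.ofReal (C + 1) := by
  refine iSup₂_le fun d hd => iSup₂_le fun k hk => ?_
  obtain ⟨hk1, hkN⟩ := Finset.mem_Icc.mp hk
  refine ENNReal.div_le_of_le_mul ?_
  have : Nonempty (Fin m) := ⟨w⟩
  obtain ⟨o, ho⟩ := exists_eq_ciInf_of_finite (f := fun c' : Fin m => (topCost k c' d : ℝ≥0∞))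
  rw [← ho]
  have hN : (0 : ℝ) < N := by exact_mod_cast lt_of_lt_of_le hk1 hkN
  have hD : (k : ℝ) * d (Sum.inr w) (Sum.inr o) ≤ C * topCost k o d := by
    have h1 := h d hd o
    have h2 := mul_sum_cost_le_mul_topCost hkN o d
    have hk0 : (0 : ℝ) ≤ k := Nat.cast_nonneg k
    refine le_of_mul_le_mul_left ?_ hN
    calc (N : ℝ) * (k * d (Sum.inr w) (Sum.inr o))
        = k * (N * d (Sum.inr w) (Sum.inr o)) := by ring
      _ ≤ k * (C * ∑ v, (cost d v o : ℝ)) := by gcongr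
      _ = C * (k * ∑ v, (cost d v o : ℝ)) := by ring
      _ ≤ C * (N * topCost k o d) := by gcongr
      _ = N * (C * topCost k o d) := by ring
  have key : topCost k w d ≤ Real.toNNReal (C + 1) * topCost k o d := by
    refine Finset.sup_le fun A hA => ?_
    have hcard : A.card = k := (Finset.mem_powersetCard.mp hA).2
    have hA' : (∑ v ∈ A, (cost d v o : ℝ)) ≤ topCost k o d := by
      exact_mod_cast sum_le_topCost hcard o d
    rw [← NNReal.coe_le_coe]
    push_cast
    rw [Real.coe_toNNReal _ (by linarith)]
    calc ∑ v ∈ A, (cost d v w : ℝ)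
        ≤ ∑ v ∈ A, ((cost d v o : ℝ) + d (Sum.inr w) (Sum.inr o)) := by
          refine Finset.sum_le_sum fun v _ => ?_
          have := hd.1.triangle (Sum.inl v) (Sum.inr o) (Sum.inr w)
          rw [hd.1.symm (Sum.inr o)] at this
          exact_mod_cast this
      _ = ∑ v ∈ A, (cost d v o : ℝ) + k * d (Sum.inr w) (Sum.inr o) := by
          rw [Finset.sum_add_distrib, Finset.sum_const, hcard, nsmul_eq_mul]
      _ ≤ (C + 1) * topCost k o d := by linarith
  have := ENNReal.coe_le_coe.mpr key
  rwa [ENNReal.coe_mul] at this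

/-! ### Lower bounds for the fairness -/

/-- The sum of all costs (`k = N`) under a single consistent metric gives a lower bound. -/
theorem le_fairness {σ : Profile N m} {d : DistFun N m} (hd : d ∈ consistentMetrics σ)
    {w o : Fin m} {R : ℝ} (hpos : 0 < ∑ v, (cost d v w : ℝ))
    (hR : R * ∑ v, (cost d v o : ℝ) ≤ ∑ v, (cost d v w : ℝ)) :
    ENNReal.ofReal R ≤ fairness w σ := by
  have hN : 1 ≤ N := by
    rcases Nat.eq_zero_or_pos N with h | h
    · subst h; simp at hpos
    · exact h
  rcases le_total R 0 with h0 | h0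
  · simp [ENNReal.ofReal_of_nonpos h0]
  refine le_trans ?_ (le_iSup₂ (f := fun d _ => metricFairness w d) d hd)
  refine le_trans ?_ (le_iSup₂ (f := fun k _ => (topCost k w d : ℝ≥0∞) /
    ⨅ c' : Fin m, (topCost k c' d : ℝ≥0∞)) N (Finset.mem_Icc.mpr ⟨hN, le_rfl⟩))
  refine le_trans ?_ (ENNReal.div_le_div_left (iInf_le _ o) _)
  simp only [topCost_univ]
  rw [ENNReal.le_div_iff_mul_le]
  · rw [ENNReal.ofReal, ← ENNReal.coe_mul, ENNReal.coe_le_coe, ← NNReal.coe_le_coe]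
    push_cast
    rwa [Real.coe_toNNReal _ h0]
  · right
    have : ∑ v, cost d v w ≠ 0 := by
      intro h
      apply hpos.ne'
      exact_mod_cast h
    exact_mod_cast this
  · exact Or.inl ENNReal.coe_ne_top

/-- A distance function with prescribed agent costs `t`. The numbers `q v` and `p c` play the role
of the distances of the agent `v` and the alternative `c` to a common hub; distinct agents are at
distance `q v + q v'`, and distinct alternatives at distance `max (p c) (p c')`. -/
def hubMetric (t : Fin N → Fin m → ℝ≥0) (q : Fin N → ℝ≥0) (p : Fin m → ℝ≥0) : DistFun N m
  | .inl v, .inl v' => if v = v' then 0 else q v + q v'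
  | .inl v, .inr c => t v c
  | .inr c, .inl v => t v c
  | .inr c, .inr c' => if c = c' then 0 else max (p c) (p c')

lemma isMetric_hubMetric {t : Fin N → Fin m → ℝ≥0} {q : Fin N → ℝ≥0} {p : Fin m → ℝ≥0}
    (h1 : ∀ v c, q v ≤ t v c) (h2 : ∀ v c, p c ≤ t v c + q v) (h3 : ∀ v c, t v c ≤ q v + p c) :
    IsMetric (hubMetric t q p) := by
  have h1' : ∀ v c, (q v : ℝ) ≤ t v c := fun v c => by exact_mod_cast h1 v c
  have h2' : ∀ v c, (p c : ℝ) ≤ t v c + q v := fun v c => by exact_mod_cast h2 v c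
  have h3' : ∀ v c, (t v c : ℝ) ≤ q v + p c := fun v c => by exact_mod_cast h3 v c
  refine ⟨?_, ?_, ?_⟩
  · rintro (v | c) <;> simp [hubMetric]
  · rintro (v | c) (v' | c') <;> simp only [hubMetric]
    · simp only [eq_comm (a := v) (b := v'), add_comm]
    · simp only [eq_comm (a := c) (b := c'), max_comm]
  · rintro (v | c) (v' | c') (v'' | c'') <;> simp only [hubMetric] <;>
      rw [← NNReal.coe_le_coe]
    · have := (q v').2
      split_ifs <;> subst_vars <;> simp_all <;> linarith
    · split_ifs with h
      · subst h; simp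
      · push_cast; linarith [h3' v c'', h2' v' c'']
    · split_ifs with h
      · exact NNReal.coe_nonneg _
      · push_cast; linarith [h1' v c', h1' v'' c']
    · split_ifs with h
      · subst h; simp
      · push_cast
        linarith [h3' v c'', h2' v c', le_max_right (p c' : ℝ) (p c''),
          le_max_left (p c' : ℝ) (p c''), h1' v c']
    · split_ifs with h
      · subst h; simp
      · push_cast; linarith [h3' v'' c, h2' v' c]
    · split_ifs with h
      · exact NNReal.coe_nonneg _
      · push_cast
        exact max_le (by linarith [h2' v' c, h1' v' c'']) (by linarith [h2' v' c'', h1' v' c])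
    · split_ifs with h
      · subst h; simp
      · push_cast
        linarith [h3' v'' c, h2' v'' c', le_max_left (p c : ℝ) (p c'), h1' v'' c']
    · by_cases h : c = c''
      · rw [if_pos h]; exact NNReal.coe_nonneg _
      by_cases h' : c = c'
      · subst h'; simp
      by_cases h'' : c' = c''
      · subst h''; simp
      · rw [if_neg h, if_neg h', if_neg h'']
        push_cast
        have := (p c').coe_nonneg
        exact max_le (by linarith [le_max_left (p c : ℝ) (p c'), le_max_left (p c' : ℝ) (p c'')])
          (by linarith [le_max_right (p c' : ℝ) (p c''), le_max_right (p c : ℝ) (p c')])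

/-- The data `t`, `q`, `p` of a hub distance that is consistent with the profile of the agents
`V`, together with costs of ratio `R`, give a lower bound for the fairness. -/
theorem le_fairness_of_hub {V : Type*} [Fintype V] (e : Fin N ≃ V) (τ : V → (Fin m ≃ Fin m))
    (t : V → Fin m → ℝ≥0) (q : V → ℝ≥0) (p : Fin m → ℝ≥0)
    (h1 : ∀ v c, q v ≤ t v c) (h2 : ∀ v c, p c ≤ t v c + q v) (h3 : ∀ v c, t v c ≤ q v + p c)
    (hcons : ∀ v c c', τ v c < τ v c' → t v c ≤ t v c') {w o : Fin m} {R : ℝ}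
    (hpos : 0 < ∑ v, (t v w : ℝ)) (hR : R * ∑ v, (t v o : ℝ) ≤ ∑ v, (t v w : ℝ)) :
    ENNReal.ofReal R ≤ fairness w (fun v : Fin N => τ (e v)) := by
  have hsum : ∀ c, ∑ v, (cost (hubMetric (fun v => t (e v)) (fun v => q (e v)) p) v c : ℝ)
      = ∑ v, (t v c : ℝ) := fun c => e.sum_comp fun v => (t v c : ℝ)
  refine le_fairness (d := hubMetric (fun v => t (e v)) (fun v => q (e v)) p) (w := w) (o := o)
    ⟨isMetric_hubMetric (fun v => h1 (e v)) (fun v => h2 (e v)) (fun v => h3 (e v)),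
      fun v c c' h => hcons (e v) c c' h⟩ ?_ ?_
  · rwa [hsum]
  · rwa [hsum, hsum]

lemma one_le_fairness (hN : 1 ≤ N) (w : Fin m) (σ : Profile N m) : 1 ≤ fairness w σ := by
  have hN' : (0 : ℝ) < N := by exact_mod_cast hN
  have := le_fairness_of_hub (Equiv.refl (Fin N)) σ (fun _ _ => 1) (fun _ => 1) (fun _ => 1)
    (by simp) (by simp) (by simp) (by simp) (w := w) (o := w) (R := 1)
    (by simpa using hN') (by simp)
  simpa using this

/-- Two clusters of alternatives, `S` and its complement, at distance `1`: the agents of `A`, who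
rank `S` above its complement, sit at `S` and all other agents halfway. -/
theorem le_fairness_of_clusters {V : Type*} [Fintype V] [DecidableEq V] (e : Fin N ≃ V)
    (τ : V → (Fin m ≃ Fin m)) (S : Finset (Fin m)) (A : Finset V)
    (hA : ∀ v ∈ A, ∀ c ∈ S, ∀ c' ∉ S, τ v c < τ v c') {w o : Fin m} (ho : o ∈ S) (hw : w ∉ S)
    (hV : Nonempty V) {R : ℝ} (hR : R * (Aᶜ.card : ℝ) ≤ 2 * A.card + Aᶜ.card) :
    ENNReal.ofReal R ≤ fairness w (fun v : Fin N => τ (e v)) := by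
  have hsum : ∀ x y : ℝ, ∑ v : V, (if v ∈ A then x else y) = A.card * x + Aᶜ.card * y := by
    intro x y
    rw [← Finset.sum_add_sum_compl A, Finset.sum_congr rfl (fun v hv => if_pos hv),
      Finset.sum_congr rfl (fun v hv => if_neg (Finset.mem_compl.mp hv))]
    simp
  have hcard : (1 : ℝ) ≤ A.card + Aᶜ.card := by
    rw [← Nat.cast_add, Finset.card_add_card_compl]
    exact_mod_cast Fintype.card_pos
  have hA0 : (0 : ℝ) ≤ A.card := Nat.cast_nonneg _
  have hhalf : (1 : ℝ≥0) = 1 / 2 + 1 / 2 := (add_halves 1).symm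
  refine le_fairness_of_hub e τ
    (fun v c => if v ∈ A then (if c ∈ S then 0 else 1) else 1 / 2)
    (fun v => if v ∈ A then 0 else 1 / 2) (fun c => if c ∈ S then 0 else 1) ?_ ?_ ?_ ?_
    (w := w) (o := o) ?_ ?_
  · intro v c; split_ifs <;> simp
  · intro v c
    by_cases hv : v ∈ A <;> by_cases hc : c ∈ S <;> simp only [hv, hc, if_true, if_false] <;>
      first
        | simp; done
        | exact hhalf.le
  · intro v c
    by_cases hv : v ∈ A <;> by_cases hc : c ∈ S <;> simp [hv, hc]
  · intro v c c' h
    by_cases hv : v ∈ A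
    · simp only [hv, if_true]
      by_cases hc : c ∈ S
      · simp [hc]
      · have : c' ∉ S := fun hc' => lt_asymm h (hA v hv c' hc' c hc)
        simp [this, hc]
    · simp [hv]
  · simp only [hw, if_false, apply_ite NNReal.toReal]
    rw [hsum]
    push_cast
    linarith
  · simp only [ho, hw, if_true, if_false, apply_ite NNReal.toReal]
    rw [hsum, hsum]
    push_cast
    linarith

lemma fairness_le_totalFairness (f : ∀ N, Profile N m → Fin m) (σ : Profile N m) :
    fairness (f N σ) σ ≤ totalFairness f :=
  (le_iSup (fun σ => fairness (f N σ) σ) σ).trans (le_iSup (fun N => ruleFairness (f N)) N)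

lemma one_le_totalFairness (f : ∀ N, Profile N m → Fin m) : 1 ≤ totalFairness f :=
  (one_le_fairness le_rfl (f 1 fun _ => Equiv.refl _) fun _ => Equiv.refl _).trans
    (fairness_le_totalFairness f _)

lemma totalFairness_le {f : ∀ N, Profile N m → Fin m} {b : ℝ≥0∞}
    (h : ∀ N, 1 ≤ N → ∀ σ : Profile N m, fairness (f N σ) σ ≤ b) : totalFairness f ≤ b := by
  refine iSup_le fun N => iSup_le fun σ => ?_
  rcases Nat.eq_zero_or_pos N with rfl | hN
  · refine iSup₂_le fun d _ => iSup₂_le fun k hk => ?_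
    simp at hk
  · exact h N hN σ

/-- Every list of priorities is refined by a strict ranking. -/
lemma exists_ranking (key : Fin m → ℕ) :
    ∃ π : Fin m ≃ Fin m, ∀ c c', key c < key c' → π c < π c' := by
  refine ⟨(Tuple.sort key).symm, fun c c' h => ?_⟩
  by_contra hle
  have := Tuple.monotone_sort key (not_lt.mp hle)
  simp at this
  omega

/-! ### Upper bounds from agents who weakly prefer the winner -/

lemma dist_le_two_mul_cost {σ : Profile N m} {d : DistFun N m} (hd : d ∈ consistentMetrics σ)
    {w o : Fin m} {v : Fin N} (h : σ v w ≤ σ v o) :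
    (d (Sum.inr w) (Sum.inr o) : ℝ) ≤ 2 * cost d v o := by
  have h1 : cost d v w ≤ cost d v o := by
    rcases h.lt_or_eq with h | h
    · exact hd.2 v w o h
    · rw [(σ v).injective h]
  have h2 := hd.1.triangle (Sum.inr w) (Sum.inl v) (Sum.inr o)
  rw [hd.1.symm (Sum.inr w) (Sum.inl v)] at h2
  have h1' : (cost d v w : ℝ) ≤ cost d v o := by exact_mod_cast h1
  have h2' : (d (Sum.inr w) (Sum.inr o) : ℝ) ≤ cost d v w + cost d v o := by exact_mod_cast h2
  linarith

/-- If against every `o` at least `N / M` agents rank `w` at least as high as `o`, then the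
fairness of `w` is at most `2 * M + 1`. -/
theorem fairness_le_of_card {σ : Profile N m} {w : Fin m} {M : ℝ} (hM : 0 ≤ M)
    (h : ∀ o, (N : ℝ) ≤ M * ((Finset.univ.filter fun v => σ v w ≤ σ v o).card : ℝ)) :
    fairness w σ ≤ ENNReal.ofReal (2 * M + 1) := by
  refine fairness_le (by linarith) fun d hd o => ?_
  set B := Finset.univ.filter fun v => σ v w ≤ σ v o with hB
  have h1 : (B.card : ℝ) * d (Sum.inr w) (Sum.inr o) ≤ ∑ v ∈ B, 2 * (cost d v o : ℝ) := by
    rw [← nsmul_eq_mul]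
    exact Finset.card_nsmul_le_sum _ _ _ fun v hv =>
      dist_le_two_mul_cost hd (Finset.mem_filter.mp hv).2
  have h2 : ∑ v ∈ B, 2 * (cost d v o : ℝ) ≤ ∑ v, 2 * (cost d v o : ℝ) :=
    Finset.sum_le_univ_sum_of_nonneg fun v => by positivity
  rw [← Finset.mul_sum (s := Finset.univ)] at h2
  calc (N : ℝ) * d (Sum.inr w) (Sum.inr o)
      ≤ (M * B.card) * d (Sum.inr w) (Sum.inr o) := by gcongr; exact h o
    _ = M * (B.card * d (Sum.inr w) (Sum.inr o)) := by ring
    _ ≤ M * (2 * ∑ v, (cost d v o : ℝ)) :=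
        mul_le_mul_of_nonneg_left (h1.trans h2) hM
    _ = 2 * M * ∑ v, (cost d v o : ℝ) := by ring

theorem fairness_le_of_undominated {σ : Profile N m} {w : Fin m} (hN : 1 ≤ N)
    (hw : Undominated σ w) : fairness w σ ≤ ENNReal.ofReal (3 * N) := by
  have hN' : (1 : ℝ) ≤ N := by exact_mod_cast hN
  refine (fairness_le_of_card (M := N) (by linarith) fun o => ?_).trans
    (ENNReal.ofReal_le_ofReal (by linarith))
  have : ∃ v, σ v w ≤ σ v o := by
    by_contra! hcon
    exact hw ⟨o, hcon⟩
  obtain ⟨v, hv⟩ := this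
  have h1 : (1 : ℝ) ≤ ((Finset.univ.filter fun v => σ v w ≤ σ v o).card : ℝ) := by
    exact_mod_cast Finset.card_pos.mpr ⟨v, by simpa using hv⟩
  nlinarith

lemma sum_score (s : Fin m → ℝ) (σ : Profile N m) :
    ∑ c, score s σ c = N * ∑ i, s i := by
  unfold score
  rw [Finset.sum_comm]
  simp [fun v => (σ v).sum_comp s]

lemma fairness_plurality_le (hm : 1 ≤ m) {σ : Profile N m} {w : Fin m}
    (hw : IsScoringWinner (pluralityVector m) σ w) : fairness w σ ≤ ENNReal.ofReal (3 * m) := by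
  have hm' : (1 : ℝ) ≤ m := by exact_mod_cast hm
  refine (fairness_le_of_card (M := m) (by linarith) fun o => ?_).trans
    (ENNReal.ofReal_le_ofReal (by linarith))
  have h1 : ∑ i, pluralityVector m i = 1 := by
    rw [Finset.sum_eq_single (⟨0, hm⟩ : Fin m)]
    · simp [pluralityVector]
    · intro i _ hi
      simp only [pluralityVector]
      rw [if_neg fun h => hi (Fin.ext h)]
    · simp
  have h2 := sum_score (pluralityVector m) σ
  rw [h1, mul_one] at h2
  have h3 : ∑ c, score (pluralityVector m) σ c ≤ m * score (pluralityVector m) σ w := by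
    have := Finset.sum_le_card_nsmul Finset.univ _ _ fun c _ => hw c
    simpa using this
  have h4 : score (pluralityVector m) σ w
      ≤ ((Finset.univ.filter fun v => σ v w ≤ σ v o).card : ℝ) := by
    rw [Finset.card_filter]
    push_cast
    refine Finset.sum_le_sum fun v _ => ?_
    simp only [pluralityVector]
    split_ifs with ha hb
    · exact le_rfl
    · exact absurd (Fin.le_def.mpr (by omega)) hb
    · exact zero_le_one
    · exact le_rfl
  nlinarith

lemma fairness_borda_le (hm : 1 ≤ m) {σ : Profile N m} {w : Fin m}
    (hw : IsScoringWinner (bordaVector m) σ w) : fairness w σ ≤ ENNReal.ofReal (3 * m) := by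
  have hm' : (1 : ℝ) ≤ m := by exact_mod_cast hm
  refine (fairness_le_of_card (M := m) (by linarith) fun o => ?_).trans
    (ENNReal.ofReal_le_ofReal (by linarith))
  have h1 := hw o
  -- An agent who prefers `o` costs `w` at least one point; every other one yields less than `m`.
  have h2 : ∑ v, (bordaVector m (σ v w) - bordaVector m (σ v o))
      ≤ ∑ v, ((m : ℝ) * (if σ v w ≤ σ v o then 1 else 0) - 1) := by
    refine Finset.sum_le_sum fun v _ => ?_
    simp only [bordaVector]
    split_ifs with h
    · have : ((σ v o : ℕ) : ℝ) + 1 ≤ m := by exact_mod_cast (σ v o).2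
      have := Nat.cast_nonneg (α := ℝ) (σ v w : ℕ)
      linarith
    · have : ((σ v o : ℕ) : ℝ) + 1 ≤ ((σ v w : ℕ) : ℝ) := by
        exact_mod_cast Fin.lt_def.mp (not_le.mp h)
      linarith
  rw [Finset.sum_sub_distrib, Finset.sum_sub_distrib, ← Finset.mul_sum] at h2
  simp only [Finset.sum_boole, Finset.sum_const, Finset.card_univ, Fintype.card_fin,
    nsmul_eq_mul, mul_one] at h2
  simp only [score] at h1
  linarith

/-! ### Agents close to an alternative -/

/-- The alternatives within distance `r` of `o`. -/
noncomputable def ball (d : DistFun N m) (o : Fin m) (r : ℝ) : Finset (Fin m) :=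
  Finset.univ.filter fun c => (d (Sum.inr o) (Sum.inr c) : ℝ) ≤ r

/-- The agents of cost at most `r` for `o`. -/
noncomputable def core (d : DistFun N m) (o : Fin m) (r : ℝ) : Finset (Fin N) :=
  Finset.univ.filter fun v => (cost d v o : ℝ) ≤ r

lemma mem_ball {d : DistFun N m} {o c : Fin m} {r : ℝ} :
    c ∈ ball d o r ↔ (d (Sum.inr o) (Sum.inr c) : ℝ) ≤ r := by simp [ball]

/-- Agents close to `o` rank a ball around `o` above everything outside of a slightly larger
one. -/
lemma lt_of_mem_core {σ : Profile N m} {d : DistFun N m} (hd : d ∈ consistentMetrics σ)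
    {o c c' : Fin m} {v : Fin N} {r s : ℝ} (hv : v ∈ core d o r) (hc : c ∈ ball d o s)
    (hc' : c' ∉ ball d o (s + 2 * r)) : σ v c < σ v c' := by
  rw [mem_ball] at hc hc'
  have hv' : (cost d v o : ℝ) ≤ r := (Finset.mem_filter.mp hv).2
  have h1 : (cost d v c : ℝ) ≤ cost d v o + d (Sum.inr o) (Sum.inr c) := by
    exact_mod_cast hd.1.triangle (Sum.inl v) (Sum.inr o) (Sum.inr c)
  have h2 : (d (Sum.inr o) (Sum.inr c') : ℝ) ≤ cost d v o + cost d v c' := by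
    have := hd.1.triangle (Sum.inr o) (Sum.inl v) (Sum.inr c')
    rw [hd.1.symm (Sum.inr o) (Sum.inl v)] at this
    exact_mod_cast this
  by_contra hle
  have h3 : cost d v c' ≤ cost d v c := by
    rcases (not_lt.mp hle).lt_or_eq with h | h
    · exact hd.2 v c' c h
    · rw [(σ v).injective h]
  have h3' : (cost d v c' : ℝ) ≤ cost d v c := by exact_mod_cast h3
  linarith

/-- Markov's inequality for the agents far from `o`. -/
lemma card_compl_core_mul_le (d : DistFun N m) (o : Fin m) (r : ℝ) :
    ((core d o r)ᶜ.card : ℝ) * r ≤ ∑ v, (cost d v o : ℝ) := by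
  have h1 : ((core d o r)ᶜ.card : ℝ) * r ≤ ∑ v ∈ (core d o r)ᶜ, (cost d v o : ℝ) := by
    rw [← nsmul_eq_mul]
    refine Finset.card_nsmul_le_sum _ _ _ fun v hv => ?_
    by_contra hcon
    exact Finset.mem_compl.mp hv (by simpa [core] using (not_le.mp hcon).le)
  exact h1.trans (Finset.sum_le_univ_sum_of_nonneg fun v => NNReal.coe_nonneg _)

/-! ### The harmonic rule: upper bound -/

lemma sum_filter_val_lt {ℓ : ℕ} (hℓ : ℓ ≤ m) (F : ℕ → ℝ) :
    ∑ i ∈ Finset.univ.filter (fun i : Fin m => (i : ℕ) < ℓ), F i = ∑ k ∈ Finset.range ℓ, F k :=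
  Finset.sum_bij (fun i _ => (i : ℕ)) (by simp) (fun _ _ _ _ h => Fin.ext h)
    (fun k hk => ⟨⟨k, (Finset.mem_range.mp hk).trans_le hℓ⟩, by simpa using hk, rfl⟩) (by simp)

lemma sum_harmonicVector {ℓ : ℕ} (hℓ : ℓ ≤ m) :
    ∑ i ∈ Finset.univ.filter (fun i : Fin m => (i : ℕ) < ℓ), harmonicVector m i
      = (harmonic ℓ : ℝ) := by
  simp only [harmonicVector]
  rw [sum_filter_val_lt hℓ (fun k => 1 / ((k : ℝ) + 1))]
  simp [harmonic]

lemma card_le_of_forall_lt (π : Fin m ≃ Fin m) (B : Finset (Fin m)) (c : Fin m)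
    (h : ∀ b ∈ B, π b < π c) : B.card ≤ (π c : ℕ) := by
  have h1 : B.card ≤ (Finset.Iio (π c)).card :=
    Finset.card_le_card_of_injOn π (fun b hb => by simpa using h b hb) π.injective.injOn
  simpa using h1

/-- If the agents of `A` rank `B` above the complement of `B'` and all of `B'` above the winner
`w`, then the winner, who scores little with the agents of `A`, has at least the average score of
`B'`. -/
lemma harmonic_mul_card_le {σ : Profile N m} {w : Fin m}
    (hw : IsScoringWinner (harmonicVector m) σ w) (A : Finset (Fin N)) (B B' : Finset (Fin m))
    (h1 : ∀ v ∈ A, ∀ c ∈ B, ∀ c' ∉ B', σ v c < σ v c') (h2 : ∀ v ∈ A, ∀ c ∈ B', σ v c < σ v w) :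
    (A.card : ℝ) * harmonic B.card ≤ B'.card * (Aᶜ.card + A.card / (B'.card + 1)) := by
  have hnn : ∀ i, 0 ≤ harmonicVector m i := fun i => by unfold harmonicVector; positivity
  have hBm : B.card ≤ m := by simpa using B.card_le_univ
  have hscore : score (harmonicVector m) σ w ≤ Aᶜ.card + A.card / (B'.card + 1) := by
    rw [score, ← Finset.sum_add_sum_compl A, add_comm]
    refine add_le_add ?_ ?_
    · refine (Finset.sum_le_card_nsmul _ _ 1 fun v _ => ?_).trans_eq (by simp)
      exact (div_le_one (by positivity)).mpr (by simp)
    · refine (Finset.sum_le_card_nsmul _ _ (1 / ((B'.card : ℝ) + 1)) fun v hv => ?_).trans_eq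
        (by simp [div_eq_mul_inv])
      have : B'.card ≤ (σ v w : ℕ) := card_le_of_forall_lt (σ v) B' w (h2 v hv)
      unfold harmonicVector
      gcongr
  have hle : ∑ c ∈ B', score (harmonicVector m) σ c
      ≤ B'.card * score (harmonicVector m) σ w := by
    simpa using Finset.sum_le_card_nsmul B' _ _ fun c _ => hw c
  have hge : (A.card : ℝ) * harmonic B.card ≤ ∑ c ∈ B', score (harmonicVector m) σ c := by
    unfold score
    rw [Finset.sum_comm]
    have hA : (A.card : ℝ) * harmonic B.card
        ≤ ∑ v ∈ A, ∑ c ∈ B', harmonicVector m (σ v c) := by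
      rw [← nsmul_eq_mul]
      refine Finset.card_nsmul_le_sum _ _ _ fun v hv => ?_
      have hsub : Finset.univ.filter (fun c => (σ v c : ℕ) < B.card) ⊆ B' := by
        intro c hc
        by_contra hcB
        have := card_le_of_forall_lt (σ v) B c fun b hb => h1 v hv b hb c hcB
        have := (Finset.mem_filter.mp hc).2
        omega
      refine le_trans (le_of_eq ?_) (Finset.sum_le_sum_of_subset_of_nonneg hsub
        fun c _ _ => hnn _)
      rw [← sum_harmonicVector hBm, Finset.sum_filter, Finset.sum_filter]
      exact ((σ v).sum_comp
        (fun i : Fin m => if (i : ℕ) < B.card then harmonicVector m i else 0)).symm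
    exact hA.trans (Finset.sum_le_univ_sum_of_nonneg fun v => Finset.sum_nonneg fun c _ => hnn _)
  calc _ ≤ _ := hge
    _ ≤ _ := hle
    _ ≤ _ := by gcongr

lemma sqrt_le_one_add_quarter {x : ℝ} (hx : 0 ≤ x) : √x ≤ 1 + x / 4 := by
  nlinarith [Real.sq_sqrt hx, sq_nonneg (√x - 2)]

lemma four_le_log : (4 : ℝ) ≤ Real.log 81 := by
  rw [Real.le_log_iff_exp_le (by norm_num)]
  have h : Real.exp 4 = Real.exp 1 ^ 4 := by rw [← Real.exp_nat_mul]; norm_num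
  rw [h]
  calc Real.exp 1 ^ 4 ≤ (3 : ℝ) ^ 4 := by
        gcongr; linarith [Real.exp_one_lt_d9]
    _ = 81 := by norm_num

/-- Two rounds of `harmonic_mul_card_le` on balls around `o`: the first one shows that about
`√m` alternatives lie close to `o`, and then the second one that the winner cannot be far away. The core has radius `D / 7`, where `D`
is the distance of the winner, as both rounds together use balls of radius up to `6 * (D / 7)`. The
constant `1134 = 2 * 7 * 81` makes the number of the other agents at most `√(log m) / (81 * m)`
times that of the core, and `81` is used through `4 ≤ log 81`. -/
lemma harmonic_central (hm : 2 ≤ m) {σ : Profile N m} {w : Fin m}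
    (hw : IsScoringWinner (harmonicVector m) σ w) {d : DistFun N m}
    (hd : d ∈ consistentMetrics σ) (o : Fin m) :
    (N : ℝ) * d (Sum.inr w) (Sum.inr o)
      ≤ 1134 * (m / √(Real.log m)) * ∑ v, (cost d v o : ℝ) := by
  by_contra! hcon
  set X := ∑ v, (cost d v o : ℝ) with hX
  set D : ℝ := (d (Sum.inr w) (Sum.inr o) : ℝ) with hD
  set L := Real.log m with hL
  have hm' : (2 : ℝ) ≤ m := by exact_mod_cast hm
  have hL0 : 0 < L := Real.log_pos (by linarith)
  have hLm : L ≤ m := (Real.log_le_sub_one_of_pos (by linarith)).trans (by linarith)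
  have hsL : 0 < √L := Real.sqrt_pos.mpr hL0
  have hsLm : √L ≤ √m := Real.sqrt_le_sqrt hLm
  have hsm : √(m : ℝ) * √m = m := Real.mul_self_sqrt (by linarith)
  have hsm1 : 1 ≤ √(m : ℝ) := Real.one_le_sqrt.mpr (by linarith)
  have hX0 : 0 ≤ X := Finset.sum_nonneg fun v _ => NNReal.coe_nonneg _
  have hND : 0 < (N : ℝ) * D := lt_of_le_of_lt (by positivity) hcon
  have hDpos : 0 < D := by
    rcases (show 0 ≤ D from NNReal.coe_nonneg _).lt_or_eq with h | h
    · exact h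
    · rw [← h, mul_zero] at hND; exact absurd hND (lt_irrefl _)
  have hNpos : (0 : ℝ) < N := pos_of_mul_pos_left hND hDpos.le
  set A := core d o (D / 7) with hA
  have hmarkov : (Aᶜ.card : ℝ) * (D / 7) ≤ X := card_compl_core_mul_le d o (D / 7)
  have hNA : (A.card : ℝ) + Aᶜ.card = N := by
    rw [← Nat.cast_add, Finset.card_add_card_compl, Fintype.card_fin]
  have hn0 : (0 : ℝ) ≤ Aᶜ.card := Nat.cast_nonneg _
  have hfew : 81 * m * (Aᶜ.card : ℝ) ≤ A.card * √L := by
    have h1 : 1134 * m * X < N * D * √L := by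
      have := mul_lt_mul_of_pos_right hcon hsL
      have e : 1134 * (m / √L) * X * √L = 1134 * m * X := by field_simp
      linarith
    have h2 : 162 * m * (Aᶜ.card : ℝ) < N * √L := by
      refine lt_of_mul_lt_mul_right (a := D) ?_ hDpos.le
      have h3 : 1134 * m * ((Aᶜ.card : ℝ) * (D / 7)) ≤ 1134 * m * X := by gcongr
      linarith
    rw [← hNA] at h2
    have h3 : (Aᶜ.card : ℝ) * √L ≤ Aᶜ.card * m := by
      gcongr
      nlinarith
    nlinarith
  have hwo : ∀ r < D, w ∉ ball d o r := fun r hr h => by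
    rw [mem_ball, hd.1.symm] at h
    linarith
  have hstep : ∀ r, r + 4 * (D / 7) < D →
      (A.card : ℝ) * harmonic (ball d o r).card
        ≤ (ball d o (r + 2 * (D / 7))).card *
          (Aᶜ.card + A.card / ((ball d o (r + 2 * (D / 7))).card + 1)) := by
    intro r hr
    refine harmonic_mul_card_le hw A _ _
      (fun v hv c hc c' hc' => lt_of_mem_core hd hv hc hc')
      (fun v hv c hc => lt_of_mem_core hd hv hc (hwo _ (by linarith)))
  have hApos : (0 : ℝ) < A.card := by
    rcases (Nat.cast_nonneg (α := ℝ) A.card).lt_or_eq with h | h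
    · exact h
    · rw [← h, zero_mul] at hfew
      have : (Aᶜ.card : ℝ) ≤ 0 := by nlinarith
      linarith
  set ℓ := (ball d o (2 * (D / 7))).card with hℓ
  have hℓ0 : (0 : ℝ) ≤ ℓ := Nat.cast_nonneg _
  -- The first round.
  have h1 : 81 * √m ≤ ((ℓ : ℝ) + 1) ^ 2 := by
    have h := hstep 0 (by linarith)
    rw [zero_add, ← hℓ] at h
    have hH : (1 : ℝ) ≤ harmonic (ball d o 0).card := by
      have hpos : 1 ≤ (ball d o 0).card :=
        Finset.card_pos.mpr ⟨o, by rw [mem_ball, hd.1.self]; simp⟩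
      have : harmonic 1 ≤ harmonic (ball d o 0).card := by
        unfold harmonic
        exact Finset.sum_le_sum_of_subset_of_nonneg (Finset.range_subset_range.mpr hpos)
          fun _ _ _ => by positivity
      rw [show harmonic 1 = 1 by simp [harmonic]] at this
      exact_mod_cast this
    have h3 : (A.card : ℝ) ≤ ℓ * (Aᶜ.card + A.card / (ℓ + 1)) :=
      le_trans (by nlinarith) h
    have h4 : (A.card : ℝ) ≤ ℓ * (ℓ + 1) * Aᶜ.card := by
      have e : (ℓ + 1) * (ℓ * ((Aᶜ.card : ℝ) + A.card / (ℓ + 1)))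
          = ℓ * (ℓ + 1) * Aᶜ.card + ℓ * A.card := by field_simp
      have := mul_le_mul_of_nonneg_left h3 (by linarith : (0 : ℝ) ≤ ℓ + 1)
      rw [e] at this
      linarith
    have hn : (0 : ℝ) < Aᶜ.card := by
      rcases hn0.lt_or_eq with h | h
      · exact h
      · rw [← h, mul_zero] at h4; linarith
    have h5 : 81 * m * (Aᶜ.card : ℝ) ≤ (ℓ + 1) ^ 2 * √m * Aᶜ.card := by
      calc 81 * m * (Aᶜ.card : ℝ) ≤ A.card * √L := hfew
        _ ≤ A.card * √m := by gcongr
        _ ≤ (ℓ * (ℓ + 1) * Aᶜ.card) * √m := by gcongr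
        _ ≤ (ℓ + 1) ^ 2 * √m * Aᶜ.card := by
          have : (0 : ℝ) ≤ (ℓ + 1) * √m * Aᶜ.card := by positivity
          nlinarith
    have h6 := le_of_mul_le_mul_right h5 hn
    refine le_of_mul_le_mul_right (a := √(m : ℝ)) ?_ (by linarith)
    rwa [mul_assoc, hsm]
  -- The second round.
  have h2 : (harmonic ℓ : ℝ) ≤ 1 + √L / 81 := by
    have h := hstep (2 * (D / 7)) (by linarith)
    rw [← hℓ] at h
    set k := (ball d o (2 * (D / 7) + 2 * (D / 7))).card with hk
    have hkm : (k : ℝ) ≤ m := by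
      have : k ≤ m := by simpa using Finset.card_le_univ (ball d o (2 * (D / 7) + 2 * (D / 7)))
      exact_mod_cast this
    have h3 : (k : ℝ) * ((Aᶜ.card : ℝ) + A.card / (k + 1)) ≤ m * Aᶜ.card + A.card := by
      have e : (k : ℝ) * (A.card / (k + 1)) ≤ A.card := by
        rw [mul_div_assoc', div_le_iff₀ (by positivity)]
        nlinarith
      have : (k : ℝ) * Aᶜ.card ≤ m * Aᶜ.card := by gcongr
      linarith
    refine le_of_mul_le_mul_left (a := (A.card : ℝ)) ?_ hApos
    linarith
  have h3 : Real.log ((ℓ : ℝ) + 1) ≤ harmonic ℓ := by exact_mod_cast log_add_one_le_harmonic ℓ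
  have h4 : Real.log (81 * √m) ≤ 2 * Real.log ((ℓ : ℝ) + 1) := by
    have := Real.log_le_log (by positivity) h1
    rwa [Real.log_pow] at this
  rw [Real.log_mul (by norm_num) (by linarith), Real.log_sqrt (by linarith)] at h4
  have h5 := four_le_log
  have h6 := sqrt_le_one_add_quarter hL0.le
  linarith

/-! ### Approval, veto and plurality: lower bounds for a given number of agents -/

lemma approvalVector_one : approvalVector 1 m = pluralityVector m := by
  funext i; simp [approvalVector, pluralityVector]

lemma vetoVector_eq_approvalVector : vetoVector m = approvalVector (m - 1) m := by
  funext i; simp only [vetoVector, approvalVector, Nat.lt_sub_iff_add_lt]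

/-- All agents but one rank the alternative `0` first and thus sit on top of it. The last agent
disapproves of it, but approves of `1` as everybody does, so that another alternative wins. -/
lemma le_ruleFairness_approval {k : ℕ} (hk : 2 ≤ k) (hkm : k < m) (hN : 1 ≤ N)
    (f : Profile N m → Fin m) (hf : ∀ σ, IsScoringWinner (approvalVector k m) σ (f σ)) :
    ENNReal.ofReal (2 * N - 1) ≤ ruleFairness f := by
  obtain ⟨m, rfl⟩ : ∃ l, m = l + 3 := ⟨m - 3, by omega⟩
  obtain ⟨N, rfl⟩ : ∃ l, N = l + 1 := ⟨N - 1, by omega⟩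
  set τ : Fin (N + 1) → (Fin (m + 3) ≃ Fin (m + 3)) := fun v =>
    if v = Fin.last N then Equiv.swap 0 (Fin.last _) else Equiv.refl _ with hτ
  have h0 : score (approvalVector k (m + 3)) τ 0 < score (approvalVector k (m + 3)) τ 1 := by
    refine Finset.sum_lt_sum (fun v _ => ?_) ⟨Fin.last N, Finset.mem_univ _, ?_⟩
    · by_cases hv : v = Fin.last N
      · simp only [hτ, hv, if_true, Equiv.swap_apply_left]
        have : ¬ (m + 2 < k) := by omega
        simp only [approvalVector, Fin.val_last, this, if_false]
        split_ifs <;> norm_num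
      · have h1 : 1 < k := by omega
        simp [hτ, hv, approvalVector, show 0 < k by omega, h1]
    · have h1 : (Equiv.swap 0 (Fin.last (m + 2))) 1 = 1 := by
        refine Equiv.swap_apply_of_ne_of_ne (by simp) ?_
        simp [Fin.ext_iff]
      have h2 : ¬ (m + 2 < k) := by omega
      have h3 : 1 < k := by omega
      simp only [hτ, if_true, h1]
      simp [approvalVector, h2, h3]
  have hw : f τ ≠ 0 := fun h => absurd (hf τ 1) (by rw [h]; exact not_le.mpr h0)
  refine le_trans ?_ (le_iSup (fun σ => fairness (f σ) σ) τ)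
  refine le_fairness_of_clusters (Equiv.refl _) τ {0} {Fin.last N}ᶜ ?_ (o := 0) (by simp)
    (by simpa using hw) ⟨0⟩ ?_
  · intro v hv c hc c' hc'
    have hv' : v ≠ Fin.last N := by simpa using hv
    simp only [Finset.mem_singleton] at hc hc'
    simp only [hτ, if_neg hv', hc, Equiv.refl_apply]
    exact Fin.pos_iff_ne_zero.mpr hc'
  · rw [compl_compl, Finset.card_singleton, Finset.card_compl, Finset.card_singleton]
    simp
    linarith

/-- Two agents vote for the alternative `0`, which all other agents, voting for distinct
alternatives, rank last. -/
lemma le_ruleFairness_plurality (hm : 2 ≤ m) (hN : 2 ≤ N) (hNm : N ≤ m + 1)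
    (f : Profile N m → Fin m) (hf : ∀ σ, IsScoringWinner (pluralityVector m) σ (f σ)) :
    ENNReal.ofReal (N - 1) ≤ ruleFairness f := by
  obtain ⟨m, rfl⟩ : ∃ l, m = l + 2 := ⟨m - 2, by omega⟩
  choose rk hrk using fun key : Fin (m + 2) → ℕ => exists_ranking key
  set τ : Profile N (m + 2) := fun v => rk fun c =>
    if (v : ℕ) < 2 then (if c = 0 then 0 else 1)
    else if c = 0 then 2 else if (c : ℕ) + 1 = v then 0 else 1 with hτ
  have hfirst : ∀ v : Fin N, (v : ℕ) < 2 → τ v 0 = 0 := by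
    intro v hv
    obtain ⟨c, hc⟩ := (τ v).surjective 0
    by_cases h : c = 0
    · rwa [h] at hc
    · have := hrk (fun c => if (v : ℕ) < 2 then (if c = 0 then 0 else 1)
        else if c = 0 then 2 else if (c : ℕ) + 1 = v then 0 else 1) 0 c (by simp [hv, h])
      change τ v 0 < τ v c at this
      rw [hc] at this
      simp at this
  have hother : ∀ v : Fin N, ∀ c, c ≠ 0 → τ v c = 0 → (v : ℕ) = c + 1 := by
    intro v c hc h
    by_contra hne
    by_cases hv : (v : ℕ) < 2
    · have h0 := hfirst v hv
      exact hc ((τ v).injective (h.trans h0.symm))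
    · have hlt : (v : ℕ) - 1 < m + 2 := by omega
      have hne0 : (⟨(v : ℕ) - 1, hlt⟩ : Fin (m + 2)) ≠ 0 := by
        intro h; simp [Fin.ext_iff] at h; omega
      have := hrk (fun c => if (v : ℕ) < 2 then (if c = 0 then 0 else 1)
        else if c = 0 then 2 else if (c : ℕ) + 1 = v then 0 else 1) ⟨(v : ℕ) - 1, hlt⟩ c (by
          simp only [hv, hne0, hc, if_false]
          rw [if_pos (by omega), if_neg (by omega)]
          norm_num)
      change τ v _ < τ v c at this
      rw [h] at this
      simp at this
  have hlast : ∀ v : Fin N, ¬ (v : ℕ) < 2 → ∀ c, c ≠ 0 → τ v c < τ v 0 := by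
    intro v hv c hc
    refine hrk (fun c => if (v : ℕ) < 2 then (if c = 0 then 0 else 1)
        else if c = 0 then 2 else if (c : ℕ) + 1 = v then 0 else 1) c 0 ?_
    simp only [hv, hc, if_false, if_true]
    split_ifs <;> norm_num
  have hs0 : (2 : ℝ) ≤ score (pluralityVector (m + 2)) τ 0 := by
    have hne : (⟨0, by omega⟩ : Fin N) ≠ ⟨1, by omega⟩ := by simp
    calc (2 : ℝ) = ∑ v ∈ ({⟨0, by omega⟩, ⟨1, by omega⟩} : Finset (Fin N)),
          pluralityVector (m + 2) (τ v 0) := by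
          rw [Finset.sum_pair hne, hfirst _ (by simp), hfirst _ (by simp)]
          norm_num [pluralityVector]
      _ ≤ _ := Finset.sum_le_univ_sum_of_nonneg fun v => by
          unfold pluralityVector; split_ifs <;> norm_num
  have hs : ∀ c, c ≠ 0 → score (pluralityVector (m + 2)) τ c ≤ 1 := by
    intro c hc
    have : score (pluralityVector (m + 2)) τ c
        = ((Finset.univ.filter fun v : Fin N => ((τ v c : ℕ) = 0)).card : ℝ) := by
      rw [Finset.card_filter]; push_cast; rfl
    rw [this]
    have : (Finset.univ.filter fun v : Fin N => ((τ v c : ℕ) = 0)).card ≤ 1 := by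
      refine Finset.card_le_one.mpr fun v hv v' hv' => Fin.ext ?_
      simp only [Finset.mem_filter, Finset.mem_univ, true_and] at hv hv'
      rw [hother v c hc (Fin.ext hv), hother v' c hc (Fin.ext hv')]
    exact_mod_cast this
  have hw : f τ = 0 := by
    by_contra h
    linarith [hs _ h, hf τ 0]
  refine le_trans ?_ (le_iSup (fun σ => fairness (f σ) σ) τ)
  refine le_fairness_of_clusters (Equiv.refl _) τ {0}ᶜ {⟨0, by omega⟩, ⟨1, by omega⟩}ᶜ ?_
    (o := 1) (by simp) (by simp [hw]) ⟨⟨0, by omega⟩⟩ ?_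
  · intro v hv c hc c' hc'
    simp only [Finset.mem_compl, Finset.mem_singleton, not_not] at hc hc'
    subst hc'
    refine hlast v (fun h => ?_) c hc
    have hv' : v ≠ ⟨0, by omega⟩ ∧ v ≠ ⟨1, by omega⟩ := by simpa using hv
    have h1 := hv'.1
    have h2 := hv'.2
    simp only [ne_eq, Fin.ext_iff] at h1 h2
    omega
  · rw [compl_compl, Finset.card_compl, Finset.card_pair (by simp), Fintype.card_fin,
      Nat.cast_sub hN]
    push_cast
    linarith

/-! ### A lower bound for scoring rules -/

/-- Permutations that rotate the first `i` positions, so that on average each of these positions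
is taken by each of them. -/
lemma exists_rotations {i : ℕ} (him : i ≤ m) : ∃ ρ : Fin i → (Fin m ≃ Fin m),
    (∀ r, ∀ c : Fin m, (c : ℕ) < i → (ρ r c : ℕ) < i) ∧
    (∀ r, ∀ c : Fin m, ¬ (c : ℕ) < i → ρ r c = c) ∧
    ∀ c : Fin m, (c : ℕ) < i → ∀ F : Fin m → ℝ,
      ∑ r, F (ρ r c) = ∑ x ∈ Finset.univ.filter (fun x : Fin m => (x : ℕ) < i), F x := by
  rcases Nat.eq_zero_or_pos i with rfl | hi
  · exact ⟨fun _ => Equiv.refl _, by simp, by simp, by simp⟩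
  have : NeZero i := ⟨hi.ne'⟩
  let E : Fin i ≃ {x : Fin m // (x : ℕ) < i} :=
    { toFun := fun x => ⟨⟨x, x.2.trans_le him⟩, x.2⟩
      invFun := fun x => ⟨x.1, x.2⟩
      left_inv := fun x => rfl
      right_inv := fun x => rfl }
  refine ⟨fun r => (Equiv.addRight r).extendDomain E, ?_, ?_, ?_⟩
  · intro r c hc
    change ((Equiv.addRight r).extendDomain E c : ℕ) < i
    rw [Equiv.Perm.extendDomain_apply_subtype _ E hc]
    exact (E _).2
  · intro r c hc
    exact Equiv.Perm.extendDomain_apply_not_subtype _ _ hc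
  · intro c hc F
    have h1 : ∀ r : Fin i, F ((Equiv.addRight r).extendDomain E c)
        = F (E (Equiv.addLeft (⟨c, hc⟩ : Fin i) r)) := by
      intro r
      rw [Equiv.Perm.extendDomain_apply_subtype (Equiv.addRight r) E hc]
      rfl
    rw [Finset.sum_congr rfl fun r _ => h1 r,
      Equiv.sum_comp (Equiv.addLeft (⟨c, hc⟩ : Fin i)) fun r => F (E r),
      E.sum_comp fun x : {x : Fin m // (x : ℕ) < i} => F x.1]
    exact Finset.sum_subtype_eq_sum_filter (f := F) (p := fun x : Fin m => (x : ℕ) < i) ▸ by simp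

/-- The alternatives are split into the first `i` and the rest. For each rotation of the first
group there are `n` agents who rank this group at the top, and one agent who ranks according to
`π`. If the hypothesis `h` on the scores holds, then the alternative `i` beats the whole
first group. -/
theorem le_totalFairness_of_scores (s : Fin m → ℝ) (f : ∀ N, Profile N m → Fin m)
    (hf : ∀ N σ, IsScoringWinner s σ (f N σ)) (i : Fin m) (hi : 0 < (i : ℕ)) (n : ℕ)
    (π : Fin m ≃ Fin m)
    (h : n * (∑ x ∈ Finset.univ.filter (· < i), s x - i * s i)
      < i * s (π i) - ∑ x ∈ Finset.univ.filter (· < i), s (π x)) :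
    ENNReal.ofReal (2 * n + 1) ≤ totalFairness f := by
  obtain ⟨ρ, hρ1, hρ2, hρ3⟩ := exists_rotations (m := m) (i := i) i.2.le
  let V := Option (Fin n) × Fin i
  let τ : V → (Fin m ≃ Fin m) := fun v => (ρ v.2).trans (v.1.elim π fun _ => Equiv.refl _)
  let e : Fin (Fintype.card V) ≃ V := (Fintype.equivFin V).symm
  let σ : Profile (Fintype.card V) m := fun v => τ (e v)
  have hscore : ∀ c, score s σ c = ∑ r, s (π (ρ r c)) + n * ∑ r, s (ρ r c) := by
    intro c
    have h1 : score s σ c = ∑ v : V, s (τ v c) := e.sum_comp fun v => s (τ v c)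
    rw [h1, Fintype.sum_prod_type, Fintype.sum_option]
    simp [τ]
  have hlow : ∀ c, c < i → score s σ c = ∑ x ∈ Finset.univ.filter (· < i), s (π x)
      + n * ∑ x ∈ Finset.univ.filter (· < i), s x := by
    intro c hc
    rw [hscore, hρ3 c hc fun x => s (π x), hρ3 c hc s]
    rfl
  have hi' : score s σ i = i * s (π i) + n * (i * s i) := by
    rw [hscore]
    simp [hρ2 _ i (lt_irrefl _)]
  have hw : ¬ f _ σ < i := fun hlt => by
    have h1 := hf _ σ i
    rw [hlow _ hlt, hi'] at h1
    linarith
  refine le_trans ?_ (fairness_le_totalFairness f σ)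
  have hcardc : ((Finset.univ.filter fun v : V => v.1 ≠ none)ᶜ).card = (i : ℕ) := by
    have : (Finset.univ.filter fun v : V => v.1 ≠ none)ᶜ = {none} ×ˢ Finset.univ := by
      ext ⟨a, b⟩
      simp only [Finset.mem_compl, Finset.mem_filter, Finset.mem_univ, true_and, not_not]
      exact (Iff.trans Finset.mem_product (by simp)).symm
    rw [this, Finset.card_product]
    simp
  have hcard : (Finset.univ.filter fun v : V => v.1 ≠ none).card = n * i := by
    have h1 := Finset.card_add_card_compl (Finset.univ.filter fun v : V => v.1 ≠ none)
    rw [hcardc] at h1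
    have h2 : Fintype.card V = n * i + i := by simp [V, add_mul]
    omega
  refine le_fairness_of_clusters e τ (Finset.univ.filter (· < i))
    (Finset.univ.filter fun v : V => v.1 ≠ none) ?_ (o := ⟨0, i.pos⟩)
    (Finset.mem_filter.mpr ⟨Finset.mem_univ _, Fin.lt_def.mpr hi⟩) (by simpa using hw)
    ⟨(none, ⟨0, hi⟩)⟩ ?_
  · rintro ⟨a, r⟩ hv c hc c' hc'
    simp only [Finset.mem_filter, Finset.mem_univ, true_and] at hv hc hc'
    obtain ⟨a, rfl⟩ := Option.ne_none_iff_exists'.mp hv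
    have h1 := hρ1 r c hc
    have h2 := hρ2 r c' hc'
    simp only [τ, Option.elim, Equiv.trans_apply, Equiv.refl_apply, h2]
    exact lt_of_lt_of_le h1 (not_lt.mp hc')
  · rw [hcardc, hcard]
    push_cast
    linarith

lemma card_filter_lt (i : Fin m) : (Finset.univ.filter (· < i)).card = (i : ℕ) := by
  rw [← Fin.card_Iio i]
  congr 1
  ext x
  simp

lemma le_totalFairness_plurality (f : ∀ N, Profile N m → Fin m)
    (hf : ∀ N σ, IsScoringWinner (pluralityVector m) σ (f N σ)) :
    ENNReal.ofReal (1 / 3 * m) ≤ totalFairness f := by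
  rcases le_or_gt m 1 with hm | hm
  · refine le_trans (ENNReal.ofReal_le_one.mpr ?_) (one_le_totalFairness f)
    have : (m : ℝ) ≤ 1 := by exact_mod_cast hm
    linarith
  · refine le_trans (ENNReal.ofReal_le_ofReal ?_) ((le_ruleFairness_plurality (N := m + 1) hm
      (by omega) le_rfl (f _) (hf _)).trans (le_iSup (fun N => ruleFairness (f N)) _))
    push_cast
    linarith [Nat.cast_nonneg (α := ℝ) m]

lemma le_totalFairness_borda (f : ∀ N, Profile N m → Fin m)
    (hf : ∀ N σ, IsScoringWinner (bordaVector m) σ (f N σ)) :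
    ENNReal.ofReal (1 / 3 * m) ≤ totalFairness f := by
  rcases le_or_gt m 3 with hm | hm
  · refine le_trans (ENNReal.ofReal_le_one.mpr ?_) (one_le_totalFairness f)
    have : (m : ℝ) ≤ 3 := by exact_mod_cast hm
    linarith
  · obtain ⟨m, rfl⟩ : ∃ l, m = l + 4 := ⟨m - 4, by omega⟩
    have hfil : (Finset.univ.filter fun x : Fin (m + 4) => x < 1) = {0} := by
      ext x; simp [Fin.lt_one_iff]
    have h1 : (Equiv.swap 0 (Fin.last (m + 3))) 1 = 1 :=
      Equiv.swap_apply_of_ne_of_ne (by simp) (by simp [Fin.ext_iff])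
    refine le_trans (ENNReal.ofReal_le_ofReal ?_) (le_totalFairness_of_scores (bordaVector _) f hf
      1 (by simp) (m + 1) (Equiv.swap 0 (Fin.last (m + 3))) ?_)
    · push_cast
      linarith [Nat.cast_nonneg (α := ℝ) m]
    · rw [hfil, Finset.sum_singleton, Finset.sum_singleton, h1, Equiv.swap_apply_left]
      simp [bordaVector]
      linarith

lemma half_lt_log_two : (1 / 2 : ℝ) < Real.log 2 := by linarith [Real.log_two_gt_d9]

lemma le_totalFairness_harmonic (hm : 2 ≤ m) (f : ∀ N, Profile N m → Fin m)
    (hf : ∀ N σ, IsScoringWinner (harmonicVector m) σ (f N σ)) :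
    ENNReal.ofReal (1 / 6 * (m / Real.log m)) ≤ totalFairness f := by
  obtain ⟨l, rfl⟩ : ∃ l, m = l + 2 := ⟨m - 2, by omega⟩
  set x : ℝ := ((l + 2 : ℕ) : ℝ) / (1 + Real.log ((l + 2 : ℕ) : ℝ)) with hx
  have hm' : (2 : ℝ) ≤ ((l + 2 : ℕ) : ℝ) := by exact_mod_cast hm
  have hlog : 1 / 2 < Real.log ((l + 2 : ℕ) : ℝ) :=
    half_lt_log_two.trans_le (Real.log_le_log (by norm_num) hm')
  have hlog' : Real.log ((l + 2 : ℕ) : ℝ) < ((l + 2 : ℕ) : ℝ) - 1 :=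
    Real.log_lt_sub_one_of_pos (by linarith) (by linarith)
  have hx1 : 1 ≤ x := by rw [hx, one_le_div (by linarith)]; linarith
  have hfloor : 1 ≤ ⌊x⌋₊ := Nat.le_floor (by simpa using hx1)
  have hlt := Nat.lt_floor_add_one x
  have hle := Nat.floor_le (by linarith : 0 ≤ x)
  obtain ⟨n, hn⟩ : ∃ n, ⌊x⌋₊ = n + 1 := ⟨⌊x⌋₊ - 1, by omega⟩
  rw [hn] at hlt hle
  push_cast at hlt hle
  refine le_trans (ENNReal.ofReal_le_ofReal ?_) (le_totalFairness_of_scores (harmonicVector _) f hf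
      (Fin.last (l + 1)) (by simp) n (Equiv.swap 0 (Fin.last (l + 1))) ?_)
  · have h1 : 1 / 6 * (((l + 2 : ℕ) : ℝ) / Real.log ((l + 2 : ℕ) : ℝ)) ≤ x / 2 := by
      rw [hx, mul_div_assoc', div_div, div_le_div_iff₀ (by linarith) (by linarith)]
      nlinarith
    have hn0 : (0 : ℝ) ≤ n := Nat.cast_nonneg n
    linarith
  · have hfil : (Finset.univ.filter fun x : Fin (l + 2) => x < Fin.last (l + 1))
        = Finset.univ.filter fun x : Fin (l + 2) => (x : ℕ) < l + 1 := by
      ext x; simp [Fin.lt_def]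
    have hH : (harmonic (l + 1) : ℝ) ≤ 1 + Real.log ((l + 2 : ℕ) : ℝ) := by
      refine (harmonic_le_one_add_log (l + 1)).trans ?_
      have := Real.log_le_log (x := ((l + 1 : ℕ) : ℝ)) (y := ((l + 2 : ℕ) : ℝ))
        (by positivity) (by push_cast; linarith)
      linarith
    have hH2 : (harmonic (l + 2) : ℝ) ≤ 1 + Real.log ((l + 2 : ℕ) : ℝ) :=
      harmonic_le_one_add_log (l + 2)
    have hall : ∑ x : Fin (l + 2), harmonicVector (l + 2) x = harmonic (l + 2) := by
      rw [← sum_harmonicVector (m := l + 2) le_rfl]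
      simp
    have hrest : ∑ x ∈ Finset.univ.filter (fun x : Fin (l + 2) => x < Fin.last (l + 1)),
        harmonicVector (l + 2) (Equiv.swap 0 (Fin.last (l + 1)) x) = harmonic (l + 2) - 1 := by
      have h1 : (Finset.univ.filter fun x : Fin (l + 2) => x < Fin.last (l + 1))
          = Finset.univ.erase (Fin.last (l + 1)) := by
        ext x; simp [Fin.lt_last_iff_ne_last]
      have h2 := Finset.add_sum_erase Finset.univ
        (fun x => harmonicVector (l + 2) (Equiv.swap 0 (Fin.last (l + 1)) x))
        (Finset.mem_univ (Fin.last (l + 1)))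
      rw [Equiv.sum_comp, hall, Equiv.swap_apply_right] at h2
      rw [h1]
      have h3 : harmonicVector (l + 2) 0 = 1 := by simp [harmonicVector]
      rw [h3] at h2
      linarith
    rw [hrest, hfil, sum_harmonicVector (by omega), Equiv.swap_apply_right]
    have h0 : harmonicVector (l + 2) 0 = 1 := by simp [harmonicVector]
    have h1 : 0 < ((Fin.last (l + 1) : ℕ) : ℝ) * harmonicVector (l + 2) (Fin.last (l + 1)) := by
      unfold harmonicVector
      have : (0 : ℝ) < ((Fin.last (l + 1) : ℕ) : ℝ) := by simp; positivity
      positivity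
    have h2 : ((n : ℝ) + 1) * (1 + Real.log ((l + 2 : ℕ) : ℝ)) ≤ ((l + 2 : ℕ) : ℝ) := by
      rwa [hx, le_div_iff₀ (by linarith)] at hle
    have h3 : ((Fin.last (l + 1) : ℕ) : ℝ) = ((l + 2 : ℕ) : ℝ) - 1 := by simp; ring
    rw [h0, mul_one]
    rcases Nat.eq_zero_or_pos n with rfl | hn
    · rw [Nat.cast_zero, zero_mul, h3]
      linarith
    · have hn' : (0 : ℝ) < n := by exact_mod_cast hn
      have h4 : (n : ℝ) * (harmonic (l + 1)
            - ((Fin.last (l + 1) : ℕ) : ℝ) * harmonicVector (l + 2) (Fin.last (l + 1)))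
          < n * (1 + Real.log ((l + 2 : ℕ) : ℝ)) := mul_lt_mul_of_pos_left (by linarith) hn'
      rw [h3] at h4 ⊢
      linarith

/-- If some initial segment of the positions has an average score of at most the score of the next
position, then the fairness ratio is infinite. -/
lemma le_totalFairness_of_average_le (s : Fin m → ℝ) (hs : ∃ i j, s i ≠ s j)
    (f : ∀ N, Profile N m → Fin m) (hf : ∀ N σ, IsScoringWinner s σ (f N σ)) (i : Fin m)
    (hi : 0 < (i : ℕ)) (h : ∑ x ∈ Finset.univ.filter (· < i), s x ≤ i * s i) (n : ℕ) :
    ENNReal.ofReal (2 * n + 1) ≤ totalFairness f := by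
  have : Nonempty (Fin m) := ⟨i⟩
  obtain ⟨p, hp⟩ := Finite.exists_max s
  obtain ⟨z, hz⟩ : ∃ z, s z < s p := by
    obtain ⟨a, b, hab⟩ := hs
    rcases (hp a).lt_or_eq with h1 | h1
    · exact ⟨a, h1⟩
    · exact ⟨b, (hp b).lt_of_ne fun h2 => hab (h1.trans h2.symm)⟩
  let o : Fin m := ⟨0, i.pos⟩
  have hoi : o ≠ i := fun h => by rw [← h] at hi; exact lt_irrefl _ hi
  -- A permutation that takes `i` to a best position and `0` to a worse one.
  obtain ⟨π, hπi, hπo⟩ : ∃ π : Fin m ≃ Fin m, π i = p ∧ π o = z := by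
    refine ⟨(Equiv.swap o (Equiv.swap i p z)).trans (Equiv.swap i p), ?_, ?_⟩
    · have : i ≠ Equiv.swap i p z := fun h => by
        have h2 := congrArg (Equiv.swap i p) h
        rw [Equiv.swap_apply_left, Equiv.swap_apply_self] at h2
        rw [h2] at hz
        exact lt_irrefl _ hz
      rw [Equiv.trans_apply, Equiv.swap_apply_of_ne_of_ne hoi.symm this, Equiv.swap_apply_left]
    · rw [Equiv.trans_apply, Equiv.swap_apply_left, Equiv.swap_apply_self]
  refine le_totalFairness_of_scores s f hf i hi n π ?_
  have h1 : ∑ x ∈ Finset.univ.filter (· < i), s (π x)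
      < ∑ x ∈ Finset.univ.filter (· < i), s p :=
    Finset.sum_lt_sum (fun x _ => hp _) ⟨o,
      Finset.mem_filter.mpr ⟨Finset.mem_univ _, Fin.lt_def.mpr hi⟩, by rwa [hπo]⟩
  have h2 : ∑ x ∈ Finset.univ.filter (· < i), s p = i * s p := by
    rw [Finset.sum_const, nsmul_eq_mul, card_filter_lt]
  have h3 : (n : ℝ) * (∑ x ∈ Finset.univ.filter (· < i), s x - i * s i) ≤ 0 :=
    mul_nonpos_of_nonneg_of_nonpos (Nat.cast_nonneg n) (by linarith)
  rw [hπi]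
  linarith

/-- If the average scores `a k` of the first `k` positions decrease, then the decrease
`a i - a (i + 1)`, which is `(a i - s i) / (i + 1)`, cannot be of the order of
`(s 0 - a h) / (i + 1)` for all `i < h`, as the harmonic series would make the total decrease too
large. -/
lemma le_totalFairness_of_lt_average (s : Fin m → ℝ)
    (f : ∀ N, Profile N m → Fin m) (hf : ∀ N σ, IsScoringWinner s σ (f N σ))
    (hs : ∀ i : Fin m, 0 < (i : ℕ) → i * s i < ∑ x ∈ Finset.univ.filter (· < i), s x)
    (h n : ℕ) (hh : 2 * h ≤ m) (hn : (n : ℝ) + 1 < harmonic h) :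
    ENNReal.ofReal (2 * n + 1) ≤ totalFairness f := by
  set t : ℕ → ℝ := fun k => if hk : k < m then s ⟨k, hk⟩ else 0 with ht
  have hts : ∀ i : Fin m, s i = t i := fun i => by simp [ht]
  have hsum : ∀ i : Fin m, ∑ x ∈ Finset.univ.filter (· < i), s x
      = ∑ k ∈ Finset.range i, t k := fun i => by
    rw [← sum_filter_val_lt i.2.le, Finset.sum_congr rfl fun x _ => hts x]
    rfl
  set a : ℕ → ℝ := fun k => (∑ k ∈ Finset.range k, t k) / k with ha
  have hak : ∀ k, 1 ≤ k → ∑ j ∈ Finset.range k, t j = k * a k := fun k hk => by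
    have : (k : ℝ) ≠ 0 := by exact_mod_cast (by omega : k ≠ 0)
    simp only [ha]; field_simp
  have hta : ∀ k, 1 ≤ k → k < m → t k < a k := fun k hk hkm => by
    have h1 := hs ⟨k, hkm⟩ hk
    rw [hsum, hts] at h1
    simp only [hak k hk] at h1
    exact lt_of_mul_lt_mul_left h1 (Nat.cast_nonneg k)
  have hstep : ∀ k, 1 ≤ k → a k - a (k + 1) = (a k - t k) / (k + 1) := fun k hk => by
    have h1 := hak (k + 1) (by omega)
    rw [Finset.sum_range_succ, hak k hk] at h1
    push_cast at h1
    rw [eq_div_iff (by positivity)]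
    linarith
  have hlt : ∀ k, 1 ≤ k → k < m → a (k + 1) < a k := fun k hk hkm => by
    have h1 := hstep k hk
    have h2 : 0 < (a k - t k) / (k + 1) := div_pos (by linarith [hta k hk hkm]) (by positivity)
    linarith
  have hanti : ∀ k, 1 ≤ k → ∀ j, k + j ≤ m → a (k + j) ≤ a k := by
    intro k hk j
    induction j with
    | zero => intro _; exact le_rfl
    | succ j ih =>
      intro hj
      exact (hlt (k + j) (by omega) (by omega)).le.trans (ih (by omega))
  have hh2 : 2 ≤ h := by
    by_contra hcon
    have : harmonic h ≤ 1 := by interval_cases h <;> simp [harmonic]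
    have : (harmonic h : ℝ) ≤ 1 := by exact_mod_cast this
    linarith [Nat.cast_nonneg (α := ℝ) n]
  have hΔ : 0 < a 1 - a h := by
    have h1 := hlt 1 le_rfl (by omega)
    have h2 := hanti 2 (by omega) (h - 2) (by omega)
    rw [show 2 + (h - 2) = h by omega] at h2
    linarith
  have ha1 : a 1 = t 0 := by simp [ha]
  by_contra hcon
  -- The hypothesis of `le_totalFairness_of_scores` has to fail for every `i < h`.
  have hbig : ∀ k, 1 ≤ k → k < h → a 1 - a h ≤ n * (a k - t k) := by
    intro k hk hkh
    have hkm : k < m := by omega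
    let z : Fin m := ⟨m - 1, by omega⟩
    let i : Fin m := ⟨k, hkm⟩
    have hfail := fun hyp => hcon (le_totalFairness_of_scores s f hf i hk n
      ((Equiv.swap i z).trans Fin.revPerm) hyp)
    have hfail := not_lt.mp hfail
    have hπi : s (((Equiv.swap i z).trans Fin.revPerm) i) = a 1 := by
      rw [Equiv.trans_apply, Equiv.swap_apply_left, hts, ha1]
      congr 1
      simp [z, Fin.val_rev]
      omega
    have hπ : ∑ x ∈ Finset.univ.filter (· < i), s (((Equiv.swap i z).trans Fin.revPerm) x)
        ≤ ∑ x ∈ Finset.univ.filter (· < i), a h := by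
      refine Finset.sum_le_sum fun x hx => ?_
      have hxi : x < i := by simpa using hx
      have hxk : (x : ℕ) < k := hxi
      have hxz : x ≠ z := fun h => by
        have := congrArg Fin.val h
        simp only [z] at this
        omega
      rw [Equiv.trans_apply, Equiv.swap_apply_of_ne_of_ne hxi.ne hxz, hts]
      have hval : ((Fin.revPerm x : Fin m) : ℕ) = m - (x + 1) := by simp [Fin.val_rev]
      rw [hval]
      have h1 := hta (m - (x + 1)) (by omega) (by omega)
      have h2 := hanti h (by omega) (m - (x + 1) - h) (by omega)
      rw [show h + (m - (x + 1) - h) = m - (x + 1) by omega] at h2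
      linarith
    have hcard : (Finset.univ.filter (· < i)).card = k := card_filter_lt i
    rw [Finset.sum_const, hcard, nsmul_eq_mul] at hπ
    rw [hπi, hsum, hts] at hfail
    simp only [i, hak k hk] at hfail hπ
    have hk0 : (0 : ℝ) < k := by exact_mod_cast hk
    refine le_of_mul_le_mul_left (a := (k : ℝ)) ?_ hk0
    linarith
  have htotal : ∀ j, 1 + j ≤ h → (a 1 - a h) * (harmonic (1 + j) - 1) ≤ n * (a 1 - a (1 + j)) := by
    intro j
    induction j with
    | zero => intro _; simp [harmonic]
    | succ j ih =>
      intro hj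
      have h1 := ih (by omega)
      have h2 := hbig (1 + j) (by omega) (by omega)
      have h3 := hstep (1 + j) (by omega)
      have h4 : (harmonic (1 + (j + 1)) : ℝ)
          = harmonic (1 + j) + 1 / (((1 + j : ℕ) : ℝ) + 1) := by
        rw [← add_assoc, harmonic_succ]
        push_cast
        simp
      have h5 : (a 1 - a h) * (1 / (((1 + j : ℕ) : ℝ) + 1))
          ≤ n * (a (1 + j) - a (1 + j + 1)) := by
        rw [h3, mul_one_div, mul_div_assoc']
        gcongr
      rw [h4, ← add_assoc]
      linarith
  have h1 := htotal (h - 1) (by omega)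
  rw [show 1 + (h - 1) = h by omega, mul_comm] at h1
  have h2 := le_of_mul_le_mul_right h1 hΔ
  linarith

lemma le_totalFairness_scoring (hm : 2 ≤ m) (s : Fin m → ℝ) (hs : ∃ i j, s i ≠ s j)
    (f : ∀ N, Profile N m → Fin m) (hf : ∀ N σ, IsScoringWinner s σ (f N σ)) :
    ENNReal.ofReal (1 / 2 * √(Real.log m)) ≤ totalFairness f := by
  set L := Real.log m with hL
  have hm' : (2 : ℝ) ≤ m := by exact_mod_cast hm
  have hL0 : 0 < L := Real.log_pos (by linarith)
  have key : ∀ n : ℕ, (n : ℝ) + 1 < L - Real.log 2 →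
      ENNReal.ofReal (2 * n + 1) ≤ totalFairness f := by
    intro n hn
    by_cases hex : ∃ i : Fin m, 0 < (i : ℕ) ∧ ∑ x ∈ Finset.univ.filter (· < i), s x ≤ i * s i
    · obtain ⟨i, hi, h⟩ := hex
      exact le_totalFairness_of_average_le s hs f hf i hi h n
    · push Not at hex
      refine le_totalFairness_of_lt_average s f hf hex (m / 2) n (by omega) (hn.trans_le ?_)
      have h1 : (m : ℝ) / 2 ≤ ((m / 2 : ℕ) : ℝ) + 1 := by
        have : m ≤ 2 * (m / 2 + 1) := by omega
        have : (m : ℝ) ≤ 2 * (((m / 2 : ℕ) : ℝ) + 1) := by exact_mod_cast this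
        linarith
      have h2 := Real.log_le_log (by positivity) h1
      rw [Real.log_div (by linarith) (by norm_num)] at h2
      exact h2.trans (by exact_mod_cast log_add_one_le_harmonic (m / 2))
  rcases le_or_gt L 4 with h4 | h4
  · refine le_trans (ENNReal.ofReal_le_one.mpr ?_) (one_le_totalFairness f)
    have := Real.sqrt_le_sqrt h4
    rw [show (4 : ℝ) = 2 ^ 2 by norm_num, Real.sqrt_sq (by norm_num)] at this
    linarith
  · have hfl := Nat.floor_le (by linarith : 0 ≤ L - 2)
    have hlt := Nat.lt_floor_add_one (L - 2)
    refine le_trans (ENNReal.ofReal_le_ofReal ?_)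
      (key ⌊L - 2⌋₊ (by linarith [Real.log_two_lt_d9]))
    have := sqrt_le_one_add_quarter hL0.le
    linarith

/-! ### Single transferable vote: upper bound -/

/-- The elimination times of the alternatives; the alternatives that remain when `c` is eliminated
are those whose time is at least that of `c`. -/
lemma exists_eliminationTime {σ : Profile N m} {w : Fin m} (hw : IsSTVWinner σ w) :
    ∃ t : Fin m → ℕ, Function.Injective t ∧ (∀ c, t c ≤ t w) ∧ ∀ c, c ≠ w → ∀ c', t c ≤ t c' →
      firstCount σ (Finset.univ.filter (t c ≤ t ·)) c
        ≤ firstCount σ (Finset.univ.filter (t c ≤ t ·)) c' := by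
  have key : ∀ S, STVRemaining σ S → ∃ (t : Fin m → ℕ) (n : ℕ), (∀ c ∈ S, t c = n) ∧
      (∀ c ∉ S, t c < n) ∧ (∀ c ∉ S, ∀ c' ∉ S, t c = t c' → c = c') ∧
      ∀ c ∉ S, ∀ c', t c ≤ t c' → firstCount σ (Finset.univ.filter (t c ≤ t ·)) c
        ≤ firstCount σ (Finset.univ.filter (t c ≤ t ·)) c' := by
    intro S hS
    induction hS with
    | start => exact ⟨fun _ => 0, 0, by simp, by simp, by simp, by simp⟩
    | eliminate S c hS hcard hc hmin ih =>
      obtain ⟨t, n, h1, h2, h3, h4⟩ := ih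
      let t' : Fin m → ℕ := fun x => if x ∈ S.erase c then n + 1 else t x
      have hin : ∀ x ∈ S.erase c, t' x = n + 1 := fun x hx => if_pos hx
      have hout : ∀ x ∉ S, t' x = t x := fun x hx =>
        if_neg fun h => hx (Finset.mem_of_mem_erase h)
      have hc' : t' c = n := (if_neg (by simp)).trans (h1 c hc)
      have hcases : ∀ x ∉ S.erase c, x = c ∨ x ∉ S := fun x hx => by
        by_contra! h
        exact hx (Finset.mem_erase.mpr h)
      have hS' : ∀ x, n ≤ t' x ↔ x ∈ S := fun x => by
        constructor
        · intro h
          by_contra hx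
          rw [hout x hx] at h
          exact absurd (h2 x hx) (not_lt.mpr h)
        · intro hx
          by_cases hxc : x = c
          · rw [hxc, hc']
          · rw [hin x (Finset.mem_erase.mpr ⟨hxc, hx⟩)]; omega
      have hle : ∀ x ∉ S, ∀ y, t' x ≤ t' y ↔ t x ≤ t y := fun x hx y => by
        have hlt := h2 x hx
        rw [hout x hx]
        by_cases hy : y ∈ S
        · have := (hS' y).mpr hy
          rw [h1 y hy]
          constructor <;> intro <;> omega
        · rw [hout y hy]
      refine ⟨t', n + 1, hin, ?_, ?_, ?_⟩
      · intro x hx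
        rcases hcases x hx with rfl | h
        · omega
        · rw [hout x h]; exact (h2 x h).trans (Nat.lt_succ_self n)
      · intro x hx y hy hxy
        rcases hcases x hx with rfl | hx' <;> rcases hcases y hy with rfl | hy'
        · rfl
        · rw [hc', hout y hy'] at hxy; exact absurd (h2 y hy') (by omega)
        · rw [hc', hout x hx'] at hxy; exact absurd (h2 x hx') (by omega)
        · rw [hout x hx', hout y hy'] at hxy; exact h3 x hx' y hy' hxy
      · intro x hx y hxy
        rcases hcases x hx with rfl | hx'
        · have hfil : Finset.univ.filter (t' x ≤ t' ·) = S := by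
            ext z; simp [hc', hS']
          rw [hfil]
          exact hmin y ((hS' y).mp (hc' ▸ hxy))
        · have hfil : Finset.univ.filter (t' x ≤ t' ·) = Finset.univ.filter (t x ≤ t ·) := by
            ext z; simp [hle x hx' z]
          rw [hfil]
          exact h4 x hx' y ((hle x hx' y).mp hxy)
  obtain ⟨t, n, h1, h2, h3, h4⟩ := key {w} hw
  have hw' : t w = n := h1 w (by simp)
  refine ⟨t, fun x y hxy => ?_, fun c => ?_, fun c hc => h4 c (by simpa using hc)⟩
  · by_cases hx : x = w <;> by_cases hy : y = w
    · rw [hx, hy]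
    · have := h2 y (by simpa using hy); rw [hx] at hxy; omega
    · have := h2 x (by simpa using hx); rw [hy] at hxy; omega
    · exact h3 x (by simpa using hx) y (by simpa using hy) hxy
  · by_cases hc : c = w
    · rw [hc]
    · have := h2 c (by simpa using hc); omega

/-- Consider the moment at which the last alternative `e` of `B` is eliminated, and let the agents
of `A` rank `B` above the complement of `B'`. Their votes then go to the set `A'` of those
alternatives of `B'` that are still there. Let all of `Z` outlast `A'`. When `c ∈ A'` is
eliminated, every member of `Z` has at least as many votes as `c`, and these come from outside of
`A` or from agents whose earlier choice in `A'` has been eliminated before `c`. So the number of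
the latter grows slowly if `Z` is large. -/
lemma four_mul_card_le {σ : Profile N m} {w : Fin m} {t : Fin m → ℕ}
    (ht : Function.Injective t)
    (helim : ∀ c, c ≠ w → ∀ c', t c ≤ t c' →
      firstCount σ (Finset.univ.filter (t c ≤ t ·)) c
        ≤ firstCount σ (Finset.univ.filter (t c ≤ t ·)) c')
    {A : Finset (Fin N)} (hN : 1 ≤ N) (hA : 81 * Aᶜ.card ≤ N) {B B' Z : Finset (Fin m)}
    (hB : ∀ v ∈ A, ∀ c ∈ B, ∀ c' ∉ B', σ v c < σ v c') (hw : w ∉ B') {e : Fin m} (he : e ∈ B)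
    (hZ : ∀ z ∈ Z, z ∉ B' ∧ t e ≤ t z ∧ ∀ c ∈ B', t c ≤ t z) (hZne : Z.Nonempty) :
    4 * Z.card ≤ (B'.filter (t e ≤ t ·)).card := by
  classical
  set A' := B'.filter (t e ≤ t ·) with hA'
  -- the favourite of each agent just before `e` is eliminated
  have htop : ∀ v, ∃ c, t e ≤ t c ∧ ∀ c', t e ≤ t c' → σ v c ≤ σ v c' := fun v => by
    obtain ⟨c, hc, hmin⟩ := Finset.exists_min_image (Finset.univ.filter (t e ≤ t ·)) (σ v)
      ⟨e, by simp⟩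
    exact ⟨c, by simpa using hc, fun c' hc' => hmin c' (by simpa using hc')⟩
  choose top htop1 htop2 using htop
  have htopA : ∀ v ∈ A, top v ∈ A' := fun v hv => by
    refine Finset.mem_filter.mpr ⟨?_, htop1 v⟩
    by_contra hcon
    exact absurd (hB v hv e he _ hcon) (not_lt.mpr (htop2 v e le_rfl))
  set g : ℕ → ℕ := fun k => Aᶜ.card + (A.filter fun v => t (top v) < k).card with hg
  have hstep : ∀ c ∈ A', Z.card * (A.filter fun v => top v = c).card ≤ g (t c) := by
    intro c hc
    obtain ⟨hcB, hce⟩ := Finset.mem_filter.mp hc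
    have hcw : c ≠ w := fun h => hw (h ▸ hcB)
    set R := Finset.univ.filter (t c ≤ t ·) with hR
    have hmemR : ∀ x, x ∈ R ↔ t c ≤ t x := fun x => by simp [hR]
    have h1 : (A.filter fun v => top v = c).card ≤ firstCount σ R c := by
      refine Finset.card_le_card fun v hv => ?_
      obtain ⟨hvA, hvc⟩ := Finset.mem_filter.mp hv
      refine Finset.mem_filter.mpr ⟨Finset.mem_univ _, fun c' hc' hne => ?_⟩
      have h2 := htop2 v c' (hce.trans ((hmemR c').mp hc'))
      rw [hvc] at h2
      exact lt_of_le_of_ne h2 fun h => hne ((σ v).injective h).symm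
    have h2 : ∀ z ∈ Z, (A.filter fun v => top v = c).card ≤ firstCount σ R z := fun z hz =>
      h1.trans (helim c hcw z ((hZ z hz).2.2 c hcB))
    have h3 : ∑ z ∈ Z, firstCount σ R z ≤ g (t c) := by
      unfold firstCount
      rw [← Finset.card_biUnion]
      · refine le_trans (Finset.card_le_card ?_)
          (Finset.card_union_le Aᶜ (A.filter fun v => t (top v) < t c))
        intro v hv
        obtain ⟨z, hz, hvz⟩ := Finset.mem_biUnion.mp hv
        have hvz := (Finset.mem_filter.mp hvz).2
        by_cases hvA : v ∈ A
        · refine Finset.mem_union_right _ (Finset.mem_filter.mpr ⟨hvA, ?_⟩)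
          by_contra hcon
          have hne : top v ≠ z := fun h => (hZ z hz).1 (h ▸ (Finset.mem_filter.mp (htopA v hvA)).1)
          exact absurd (hvz (top v) ((hmemR _).mpr (not_lt.mp hcon)) hne)
            (not_lt.mpr (htop2 v z (hZ z hz).2.1))
        · exact Finset.mem_union_left _ (Finset.mem_compl.mpr hvA)
      · intro z hz z' hz' hne
        refine Finset.disjoint_left.mpr fun v hv hv' => ?_
        have h4 := (Finset.mem_filter.mp hv).2 z' ((hmemR _).mpr ((hZ z' hz').2.2 c hcB)) hne.symm
        have h5 := (Finset.mem_filter.mp hv').2 z ((hmemR _).mpr ((hZ z hz).2.2 c hcB)) hne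
        exact lt_asymm h4 h5
    exact (by simpa using Finset.card_nsmul_le_sum Z _ _ h2 :
      Z.card * (A.filter fun v => top v = c).card ≤ _).trans h3
  have hb : (0 : ℝ) < Z.card := by exact_mod_cast hZne.card_pos
  have hgrow : ∀ k, (g k : ℝ) ≤ Aᶜ.card * (1 + 1 / (Z.card : ℝ)) ^ (A'.filter (t · < k)).card := by
    intro k
    induction k with
    | zero => simp [hg]
    | succ k ih =>
      have hsplit : g (k + 1) = g k + (A.filter fun v => t (top v) = k).card := by
        have h1 : A.filter (fun v => t (top v) < k + 1)
            = A.filter (fun v => t (top v) < k) ∪ A.filter (fun v => t (top v) = k) := by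
          rw [← Finset.filter_or]
          refine Finset.filter_congr fun v _ => ?_
          omega
        have h2 : Disjoint (A.filter fun v => t (top v) < k) (A.filter fun v => t (top v) = k) :=
          Finset.disjoint_filter.mpr fun v _ h h' => by omega
        simp only [hg]
        rw [h1, Finset.card_union_of_disjoint h2]
        ring
      by_cases hex : ∃ c ∈ A', t c = k
      · obtain ⟨c, hc, rfl⟩ := hex
        have h1 : A.filter (fun v => t (top v) = t c) = A.filter fun v => top v = c :=
          Finset.filter_congr fun v _ => ht.eq_iff
        have h2 : A'.filter (t · < t c + 1) = insert c (A'.filter (t · < t c)) := by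
          ext x
          simp only [Finset.mem_filter, Finset.mem_insert, Nat.lt_succ_iff_lt_or_eq, ht.eq_iff]
          constructor
          · rintro ⟨hx, h | h⟩
            · exact Or.inr ⟨hx, h⟩
            · exact Or.inl h
          · rintro (h | h)
            · exact ⟨h ▸ hc, Or.inr h⟩
            · exact ⟨h.1, Or.inl h.2⟩
        have h3 : (Z.card : ℝ) * (A.filter fun v => top v = c).card ≤ g (t c) := by
          exact_mod_cast hstep c hc
        have h4 : ((A.filter fun v => top v = c).card : ℝ) ≤ g (t c) * (1 / (Z.card : ℝ)) := by
          rw [mul_one_div, le_div_iff₀ hb]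
          linarith
        rw [hsplit, h1, h2, Finset.card_insert_of_notMem (by simp), pow_succ]
        push_cast
        have h5 : (0 : ℝ) ≤ 1 + 1 / (Z.card : ℝ) := by positivity
        have h6 := mul_le_mul_of_nonneg_right ih h5
        linarith
      · have h1 : A.filter (fun v => t (top v) = k) = ∅ :=
          Finset.filter_eq_empty_iff.mpr fun v hv h => hex ⟨_, htopA v hv, h⟩
        have h2 : A'.filter (t · < k + 1) = A'.filter (t · < k) :=
          Finset.filter_congr fun c hc => by
            have : t c ≠ k := fun h => hex ⟨c, hc, h⟩
            omega
        rw [hsplit, h1, h2, Finset.card_empty, add_zero]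
        exact ih
  -- At the end all agents of `A` are counted.
  obtain ⟨K, hK⟩ : ∃ K, ∀ c, t c < K :=
    ⟨Finset.univ.sup t + 1, fun c => Nat.lt_succ_of_le (Finset.le_sup (Finset.mem_univ c))⟩
  have h1 := hgrow K
  have h2 : g K = N := by
    simp only [hg]
    rw [Finset.filter_true_of_mem fun v _ => hK _, add_comm, Finset.card_add_card_compl,
      Fintype.card_fin]
  rw [h2, Finset.filter_true_of_mem fun c _ => hK c] at h1
  have h3 : (1 + 1 / (Z.card : ℝ)) ^ A'.card ≤ Real.exp (A'.card / Z.card) := by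
    calc (1 + 1 / (Z.card : ℝ)) ^ A'.card ≤ Real.exp (1 / Z.card) ^ A'.card := by
          gcongr
          rw [add_comm]
          exact Real.add_one_le_exp _
      _ = Real.exp (A'.card / Z.card) := by
          rw [← Real.exp_nat_mul, mul_one_div]
  have hAr : 81 * (Aᶜ.card : ℝ) ≤ N := by exact_mod_cast hA
  have hNr : (1 : ℝ) ≤ N := by exact_mod_cast hN
  have hn : (0 : ℝ) < Aᶜ.card := by
    rcases (Nat.cast_nonneg (α := ℝ) Aᶜ.card).lt_or_eq with h | h
    · exact h
    · rw [← h, zero_mul] at h1; linarith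
  have h4 : 81 ≤ Real.exp (A'.card / Z.card) := by
    refine le_of_mul_le_mul_left ?_ hn
    calc (Aᶜ.card : ℝ) * 81 ≤ N := by linarith
      _ ≤ _ := h1
      _ ≤ _ := by gcongr
  have h5 : Real.log 81 ≤ A'.card / Z.card := by
    rw [Real.log_le_iff_le_exp (by norm_num)]
    exact h4
  have h6 := four_le_log.trans h5
  rw [le_div_iff₀ hb] at h6
  exact_mod_cast h6

/-- If most agents rank each set of an increasing chain above everything outside of the next set,
then a winner outside of the chain forces the number of alternatives that survive a set of the
chain to shrink by half from one set to the next. -/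
lemma two_pow_le_of_chain {σ : Profile N m} {w : Fin m} (hw : IsSTVWinner σ w)
    {A : Finset (Fin N)} (hN : 1 ≤ N) (hA : 81 * Aᶜ.card ≤ N) {B : ℕ → Finset (Fin m)}
    (hmono : Monotone B) {o : Fin m} (ho : o ∈ B 0)
    (hB : ∀ j, ∀ v ∈ A, ∀ c ∈ B j, ∀ c' ∉ B (j + 1), σ v c < σ v c') {J : ℕ}
    (hwJ : w ∉ B (J + 1)) : 2 ^ J ≤ m := by
  obtain ⟨t, ht, htw, helim⟩ := exists_eliminationTime hw
  have hlast : ∀ j, ∃ e ∈ B j, ∀ c ∈ B j, t c ≤ t e := fun j =>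
    Finset.exists_max_image (B j) t ⟨o, hmono (Nat.zero_le j) ho⟩
  choose e he hemax using hlast
  set Q : ℕ → Finset (Fin m) := fun j => (B (j + 1)).filter (t (e j) < t ·) with hQ
  have hcard : ∀ j, ((B (j + 1)).filter (t (e j) ≤ t ·)).card = (Q j).card + 1 := by
    intro j
    rw [← Finset.card_insert_of_notMem (s := Q j) (a := e j) (by simp [hQ])]
    congr 1
    ext x
    simp only [hQ, Finset.mem_filter, Finset.mem_insert, le_iff_lt_or_eq, ht.eq_iff]
    constructor
    · rintro ⟨hx, h | h⟩
      · exact Or.inr ⟨hx, h⟩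
      · exact Or.inl h.symm
    · rintro (h | h)
      · exact ⟨h ▸ hmono (Nat.le_succ j) (he j), Or.inr h.symm⟩
      · exact ⟨h.1, Or.inl h.2⟩
  have hwj : ∀ j ≤ J, w ∉ B (j + 1) := fun j hj h => hwJ (hmono (by omega) h)
  have hpos : ∀ j ≤ J, 1 ≤ (Q j).card := by
    intro j hj
    have h1 := four_mul_card_le ht helim hN hA (hB j) (hwj j hj) (he j) (Z := {w})
      (fun z hz => by
        rw [Finset.mem_singleton.mp hz]
        exact ⟨hwj j hj, htw _, fun c _ => htw c⟩) (by simp)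
    rw [hcard, Finset.card_singleton] at h1
    omega
  have hmain : ∀ j ≤ J, 2 ^ j * (Q j).card ≤ m := by
    intro j
    induction j with
    | zero =>
      intro _
      simpa using Finset.card_le_univ (Q 0)
    | succ j ih =>
      intro hj
      have h1 := four_mul_card_le ht helim hN hA (hB j) (hwj j (by omega)) (he j) (Z := Q (j + 1))
        (fun z hz => by
          have hz' := (Finset.mem_filter.mp hz).2
          refine ⟨fun h => absurd (hemax _ z h) (not_le.mpr hz'), ?_, fun c hc =>
            (hemax _ c hc).trans hz'.le⟩
          exact (hemax (j + 1) _ (hmono (Nat.le_succ j) (he j))).trans hz'.le)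
        (Finset.card_pos.mp (hpos (j + 1) hj))
      rw [hcard] at h1
      have h2 := hpos j (by omega)
      have h3 := ih (by omega)
      calc 2 ^ (j + 1) * (Q (j + 1)).card = 2 ^ j * (2 * (Q (j + 1)).card) := by ring
        _ ≤ 2 ^ j * (Q j).card := by gcongr; omega
        _ ≤ m := h3
  calc 2 ^ J ≤ 2 ^ J * (Q J).card := Nat.le_mul_of_pos_right _ (hpos J le_rfl)
    _ ≤ m := hmain J le_rfl

/-- The core of radius `81` times the average cost contains all but one in `81` of the agents, and
the balls of the chain grow by twice this radius. -/
lemma stv_central {σ : Profile N m} {w : Fin m} (hw : IsSTVWinner σ w) (hN : 1 ≤ N)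
    {d : DistFun N m} (hd : d ∈ consistentMetrics σ) (o : Fin m) :
    (N : ℝ) * d (Sum.inr w) (Sum.inr o) ≤ 162 * (Nat.log 2 m + 2) * ∑ v, (cost d v o : ℝ) := by
  set X := ∑ v, (cost d v o : ℝ) with hX
  have hX0 : 0 ≤ X := Finset.sum_nonneg fun v _ => NNReal.coe_nonneg _
  have hN0 : (0 : ℝ) < N := by exact_mod_cast hN
  set r := 81 * X / N with hr
  have hr0 : 0 ≤ r := by positivity
  have hA : 81 * (core d o r)ᶜ.card ≤ N := by
    have hmarkov : ((core d o r)ᶜ.card : ℝ) * r ≤ X := card_compl_core_mul_le d o r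
    rcases hX0.lt_or_eq with h | h
    · have h1 : 81 * ((core d o r)ᶜ.card : ℝ) * X ≤ N * X := by
        rw [hr, mul_div_assoc', div_le_iff₀ hN0] at hmarkov
        linarith
      exact_mod_cast le_of_mul_le_mul_right h1 h
    · have h1 : (core d o r)ᶜ = ∅ := by
        rw [Finset.compl_eq_empty_iff, Finset.eq_univ_iff_forall]
        intro v
        have h2 : (cost d v o : ℝ) ≤ X := Finset.single_le_sum (f := fun v => (cost d v o : ℝ))
          (fun v _ => NNReal.coe_nonneg _) (Finset.mem_univ v)
        exact Finset.mem_filter.mpr ⟨Finset.mem_univ _, by linarith⟩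
      simp [h1]
  have hball : w ∈ ball d o (((Nat.log 2 m + 1 + 1 : ℕ) : ℝ) * (2 * r)) := by
    by_contra hcon
    have h1 := two_pow_le_of_chain hw hN hA (B := fun j => ball d o ((j : ℝ) * (2 * r)))
      (fun i j hij c hc => by
        rw [mem_ball] at hc ⊢
        refine hc.trans ?_
        gcongr) (o := o) (by rw [mem_ball, hd.1.self]; simp)
      (fun j v hv c hc c' hc' => lt_of_mem_core hd hv hc (by
        have : (j : ℝ) * (2 * r) + 2 * r = ((j + 1 : ℕ) : ℝ) * (2 * r) := by push_cast; ring
        rwa [this])) hcon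
    exact absurd h1 (not_le.mpr (Nat.lt_pow_succ_log_self (by norm_num) m))
  rw [mem_ball, hd.1.symm] at hball
  calc (N : ℝ) * d (Sum.inr w) (Sum.inr o)
      ≤ N * (((Nat.log 2 m + 1 + 1 : ℕ) : ℝ) * (2 * r)) := by gcongr
    _ = 162 * (Nat.log 2 m + 2) * X := by
      rw [hr]; push_cast; field_simp; ring

lemma natLog_le_two_mul_log (hm : m ≠ 0) : (Nat.log 2 m : ℝ) ≤ 2 * Real.log m := by
  have h1 : ((2 ^ Nat.log 2 m : ℕ) : ℝ) ≤ m := by exact_mod_cast Nat.pow_log_le_self 2 hm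
  have h2 := Real.log_le_log (by positivity) h1
  push_cast at h2
  rw [Real.log_pow] at h2
  have h3 := half_lt_log_two
  nlinarith [Nat.cast_nonneg (α := ℝ) (Nat.log 2 m)]

lemma fairness_stv_le (hm : 2 ≤ m) (hN : 1 ≤ N) {σ : Profile N m} {w : Fin m}
    (hw : IsSTVWinner σ w) : fairness w σ ≤ ENNReal.ofReal (974 * Real.log m) := by
  have hm' : (2 : ℝ) ≤ m := by exact_mod_cast hm
  have h1 := natLog_le_two_mul_log (m := m) (by omega)
  have h2 := half_lt_log_two.trans_le (Real.log_le_log (by norm_num) hm')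
  refine (fairness_le (by positivity) fun d hd o => stv_central hw hN hd o).trans
    (ENNReal.ofReal_le_ofReal ?_)
  linarith

/-! ### Single transferable vote: lower bound -/

lemma firstCount_comp_equiv {V : Type*} [Fintype V] [DecidableEq V] (e : Fin N ≃ V)
    (τ : V → (Fin m ≃ Fin m)) (S : Finset (Fin m)) (c : Fin m) :
    firstCount (fun v : Fin N => τ (e v)) S c
      = (Finset.univ.filter fun v => ∀ c' ∈ S, c' ≠ c → τ v c < τ v c').card := by
  classical
  unfold firstCount
  exact Finset.card_equiv e fun v => by
    rw [Finset.mem_filter, Finset.mem_filter]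
    simp only [Finset.mem_univ, true_and]
    rfl

/-- Alternatives on the levels `0, …, h + 1`, with a single alternative `w` on the highest level,
such that every agent `v` has an ancestor `anc v i` on each level `i + 1` with `ty v ≤ i ≤ h`. -/
structure Hierarchy (h : ℕ) (V : Type) (m : ℕ) where
  /-- the level of an alternative -/
  level : Fin m → ℕ
  /-- the level of the favourite alternative of an agent, minus one -/
  ty : V → ℕ
  /-- the ancestors of an agent -/
  anc : V → ℕ → Fin m
  /-- the alternative on the highest level -/
  w : Fin m
  level_le : ∀ c, level c ≤ h + 1
  ty_le : ∀ v, ty v ≤ h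
  level_anc : ∀ v i, ty v ≤ i → i ≤ h → level (anc v i) = i + 1
  anc_top : ∀ v, anc v h = w
  level_w : level w = h + 1
  eq_w : ∀ c, level c = h + 1 → c = w

namespace Hierarchy

variable {h : ℕ} {V : Type} (H : Hierarchy h V m)

/-- The priorities of an agent: the lowest ancestor, then everything of level `0`, then the other
levels upwards, where all but the ancestors are ranked below the ancestor of the next level. -/
def key (v : V) (c : Fin m) : ℕ :=
  if c = H.anc v (H.ty v) then 0 else if H.level c = 0 then 1
  else if c = H.anc v (H.level c - 1) ∧ H.ty v < H.level c - 1 then 2 * (H.level c - 1)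
  else 2 * (H.level c - 1) + 3

/-- The distance of an agent from the hub where all alternatives of level `0` are located. -/
def radius (v : V) : ℕ := if H.ty v = 0 then 1 else h + 1

/-- The cost of an agent for an alternative; by definition it is monotone in the priority. -/
def price (v : V) (c : Fin m) : ℕ := H.radius v + 2 * (H.key v c / 2)

lemma level_own (v : V) : H.level (H.anc v (H.ty v)) = H.ty v + 1 :=
  H.level_anc v _ le_rfl (H.ty_le v)

lemma key_own (v : V) : H.key v (H.anc v (H.ty v)) = 0 := by simp [key]

lemma key_pos {v : V} {c : Fin m} (hc : c ≠ H.anc v (H.ty v)) : 0 < H.key v c := by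
  unfold key
  rw [if_neg hc]
  split_ifs with h1 h2 <;> omega

lemma radius_le_price (v : V) (c : Fin m) : H.radius v ≤ H.price v c := Nat.le_add_right _ _

lemma radius_pos (v : V) : 1 ≤ H.radius v := by unfold radius; split_ifs <;> omega

/-- The alternative `c` is at distance `2 * level c` from the hub, which is at most the sum of the
distances from an agent to both. -/
lemma two_mul_level_le (v : V) (c : Fin m) : 2 * H.level c ≤ H.price v c + H.radius v := by
  have h1 := H.radius_pos v
  have h3 := H.ty_le v
  unfold price key
  split_ifs with ha hb hc
  · have h2 := H.level_own v
    rw [← ha] at h2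
    have h4 : H.ty v + 1 ≤ H.radius v := by unfold radius; split_ifs <;> omega
    omega
  all_goals omega

lemma price_le (v : V) (c : Fin m) : H.price v c ≤ H.radius v + 2 * H.level c := by
  unfold price key
  split_ifs <;> omega

lemma price_of_level_eq_zero (v : V) {o : Fin m} (ho : H.level o = 0) :
    H.price v o = H.radius v := by
  unfold price key
  rw [if_pos ho]
  split_ifs <;> omega

lemma le_price_w (v : V) : h + 1 ≤ H.price v H.w := by
  have h1 := H.radius_pos v
  have hlev := H.level_w
  rcases (H.ty_le v).lt_or_eq with hlt | heq
  · have hne : H.w ≠ H.anc v (H.ty v) := fun hw => by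
      have := H.level_own v
      rw [← hw, hlev] at this
      omega
    unfold price key
    rw [if_neg hne, if_neg (by omega), if_pos]
    · rw [hlev]; omega
    · rw [hlev, Nat.add_sub_cancel]
      exact ⟨(H.anc_top v).symm, hlt⟩
  · have : h + 1 ≤ H.radius v := by unfold radius; split_ifs <;> omega
    exact this.trans (H.radius_le_price v _)

variable [Fintype V]

/-- Suppose that a higher alternative is always the favourite of more agents than a lower one has
descendants. Then the levels are eliminated from below and `w` wins. -/
lemma eq_w_of_isSTVWinner [DecidableEq V] (e : Fin N ≃ V) {τ : V → (Fin m ≃ Fin m)}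
    (hτ : ∀ v c c', H.key v c < H.key v c' → τ v c < τ v c')
    (hcount : ∀ b c, H.level b < H.level c →
      (Finset.univ.filter fun v => 0 < H.level b ∧ H.ty v < H.level b ∧
        H.anc v (H.level b - 1) = b).card
      < (Finset.univ.filter fun v => H.anc v (H.ty v) = c).card)
    {w' : Fin m} (hw' : IsSTVWinner (fun v : Fin N => τ (e v)) w') : w' = H.w := by
  have hinv : ∀ S, STVRemaining (fun v : Fin N => τ (e v)) S →
      ∀ c ∈ S, ∀ c', H.level c < H.level c' → c' ∈ S := by
    intro S hS
    induction hS with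
    | start => intro c _ c' _; exact Finset.mem_univ c'
    | eliminate S c hS hcard hc hmin ih =>
      have hlow : ∀ b ∈ S, H.level c ≤ H.level b := by
        intro b hb
        by_contra! hlt
        refine absurd (hmin b hb) (not_le.mpr ?_)
        rw [firstCount_comp_equiv, firstCount_comp_equiv]
        refine (Finset.card_le_card fun v hv => ?_).trans_lt
          ((hcount b c hlt).trans_le (Finset.card_le_card fun v hv => ?_))
        · -- The supporters of `b` are descendants of `b`.
          have hv := (Finset.mem_filter.mp hv).2
          have hown := H.level_own v
          have hbest : ∀ c' ∈ S, ¬ H.key v c' < H.key v b := fun c' hc' hk => by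
            have h1 : c' ≠ b := fun h => by rw [h] at hk; exact lt_irrefl _ hk
            exact lt_asymm (hτ v _ _ hk) (hv c' hc' h1)
          have hty : H.ty v < H.level b := by
            by_contra! hcon
            have hne : b ≠ H.anc v (H.ty v) := fun hb => by rw [← hb] at hown; omega
            refine hbest _ (ih b hb (H.anc v (H.ty v)) (by omega)) ?_
            rw [key_own]
            exact H.key_pos hne
          refine Finset.mem_filter.mpr ⟨Finset.mem_univ _, by omega, hty, ?_⟩
          by_contra hne
          have hlev := H.level_le c
          have hanc := H.level_anc v (H.level b) hty.le (by omega)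
          refine hbest _ (ih b hb (H.anc v (H.level b)) (by omega)) ?_
          have hb' : b ≠ H.anc v (H.ty v) := fun h => by
            rw [← h] at hown
            rw [hown, Nat.add_sub_cancel] at hne
            exact hne h.symm
          have hb2 : H.key v b = 2 * (H.level b - 1) + 3 := by
            unfold key
            rw [if_neg hb', if_neg (by omega), if_neg fun h => hne h.1.symm]
          have hne' : H.anc v (H.level b) ≠ H.anc v (H.ty v) := fun h => by
            rw [h] at hanc; omega
          have ha : H.key v (H.anc v (H.level b)) = 2 * H.level b := by
            unfold key
            rw [hanc, if_neg hne', if_neg (by omega), Nat.add_sub_cancel, if_pos ⟨rfl, hty⟩]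
          omega
        · -- The agents whose favourite is `c` vote for it.
          have hv := (Finset.mem_filter.mp hv).2
          refine Finset.mem_filter.mpr ⟨Finset.mem_univ _, fun c' _ hne => hτ v _ _ ?_⟩
          rw [← hv] at hne ⊢
          rw [key_own]
          exact H.key_pos hne
      intro x hx x' hxx'
      have hxS := Finset.mem_of_mem_erase hx
      refine Finset.mem_erase.mpr ⟨fun h => ?_, ih x hxS x' hxx'⟩
      have := hlow x hxS
      rw [h] at hxx'
      omega
  by_contra hne
  have hlt : H.level w' < H.level H.w := by
    rw [H.level_w]
    exact lt_of_le_of_ne (H.level_le w') fun h => hne (H.eq_w w' h)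
  exact hne (Finset.mem_singleton.mp (hinv _ hw' w' (by simp) _ hlt)).symm

/-- The agents are about `h` times closer to an alternative `o` of level `0` than to `w`. -/
lemma le_fairness_w (e : Fin N ≃ V) {τ : V → (Fin m ≃ Fin m)}
    (hτ : ∀ v c c', H.key v c < H.key v c' → τ v c < τ v c') (hV : Nonempty V)
    {o : Fin m} (ho : H.level o = 0) (hr : ∑ v, (H.radius v : ℝ) ≤ 2 * Fintype.card V) :
    ENNReal.ofReal ((h + 1) / 2) ≤ fairness H.w (fun v : Fin N => τ (e v)) := by
  have hcard : (0 : ℝ) < Fintype.card V := by exact_mod_cast Fintype.card_pos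
  have hw : (Fintype.card V : ℝ) * (h + 1) ≤ ∑ v, (H.price v H.w : ℝ) := by
    rw [← nsmul_eq_mul, ← Finset.card_univ]
    exact Finset.card_nsmul_le_sum _ _ _ fun v _ => by exact_mod_cast H.le_price_w v
  refine le_fairness_of_hub e τ (fun v c => (H.price v c : ℝ≥0)) (fun v => (H.radius v : ℝ≥0))
    (fun c => ((2 * H.level c : ℕ) : ℝ≥0)) ?_ ?_ ?_ ?_ (o := o) ?_ ?_
  · exact fun v c => by exact_mod_cast H.radius_le_price v c
  · exact fun v c => by exact_mod_cast H.two_mul_level_le v c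
  · exact fun v c => by exact_mod_cast H.price_le v c
  · intro v c c' hcc'
    have h1 : H.key v c ≤ H.key v c' := by
      by_contra hcon
      exact lt_asymm hcc' (hτ v _ _ (not_le.mp hcon))
    have h2 : H.price v c ≤ H.price v c' := by unfold price; omega
    exact_mod_cast h2
  · simp only [NNReal.coe_natCast]
    exact lt_of_lt_of_le (by positivity) hw
  · simp only [NNReal.coe_natCast, H.price_of_level_eq_zero _ ho]
    calc ((h : ℝ) + 1) / 2 * ∑ v, (H.radius v : ℝ)
        ≤ ((h : ℝ) + 1) / 2 * (2 * Fintype.card V) := by gcongr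
      _ = Fintype.card V * (h + 1) := by ring
      _ ≤ _ := hw

end Hierarchy

/-- A word over `Fin r` extended by a blank is a node of level `i` if exactly its first `i` letters
are blank. -/
def IsNode {h r : ℕ} (x : Fin h → Option (Fin r)) (i : ℕ) : Prop :=
  ∀ k : Fin h, x k = none ↔ (k : ℕ) < i

/-- Replaces the first `i` letters of a word, and all special ones, by blanks. -/
def trunc {h r : ℕ} (u : Fin h → Fin r ⊕ Bool) (i : ℕ) : Fin h → Option (Fin r) :=
  fun k => if (k : ℕ) < i then none else (u k).getLeft?

/-- From position `i` on, a word has no special letters. -/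
def IsPlainFrom {h r : ℕ} (u : Fin h → Fin r ⊕ Bool) (i : ℕ) : Prop :=
  ∀ k : Fin h, i ≤ (k : ℕ) → (u k).isLeft

lemma isPlainFrom_length {h r : ℕ} (u : Fin h → Fin r ⊕ Bool) : ∃ i, IsPlainFrom u i :=
  ⟨h, fun k hk => absurd k.2 (not_lt.mpr hk)⟩

open Classical in
/-- The length of the shortest prefix of a word that contains all its special letters. -/
noncomputable def prefixLength {h r : ℕ} (u : Fin h → Fin r ⊕ Bool) : ℕ :=
  Nat.find (isPlainFrom_length u)

lemma isPlainFrom_prefixLength {h r : ℕ} (u : Fin h → Fin r ⊕ Bool) :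
    IsPlainFrom u (prefixLength u) := by
  classical exact Nat.find_spec (isPlainFrom_length u)

lemma prefixLength_le {h r : ℕ} {u : Fin h → Fin r ⊕ Bool} {i : ℕ} (hu : IsPlainFrom u i) :
    prefixLength u ≤ i := by
  classical exact Nat.find_min' (isPlainFrom_length u) hu

lemma isNode_trunc {h r : ℕ} {u : Fin h → Fin r ⊕ Bool} {i : ℕ} (hu : prefixLength u ≤ i) :
    IsNode (trunc u i) i := by
  intro k
  unfold trunc
  split_ifs with hk
  · simp [hk]
  · have := isPlainFrom_prefixLength u k (hu.trans (not_lt.mp hk))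
    obtain ⟨a, ha⟩ := Sum.isLeft_iff.mp this
    simp [ha, hk]

lemma IsNode.eq_of_le {h r : ℕ} {x : Fin h → Option (Fin r)} {i j : ℕ} (hi : IsNode x i)
    (hj : IsNode x j) (hih : i ≤ h) (hjh : j ≤ h) : i = j := by
  by_contra hne
  rcases lt_or_gt_of_ne hne with hlt | hlt
  · exact absurd ((hi ⟨i, by omega⟩).mp ((hj ⟨i, by omega⟩).mpr hlt)) (lt_irrefl i)
  · exact absurd ((hj ⟨j, by omega⟩).mp ((hi ⟨j, by omega⟩).mpr hlt)) (lt_irrefl j)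

/-- The word that agrees with `y` from position `j` on, has the special letter `s` before that, and
agrees with `u` on the remaining prefix. -/
def splice {h r : ℕ} (y : Fin h → Option (Fin r)) (j : ℕ) (s : Bool) (u : Fin h → Fin r ⊕ Bool) :
    Fin h → Fin r ⊕ Bool :=
  fun k => if j ≤ (k : ℕ) then (y k).elim (Sum.inr s) Sum.inl
    else if (k : ℕ) + 1 = j then Sum.inr s else u k

lemma prefixLength_splice {h r : ℕ} {y : Fin h → Option (Fin r)} {j : ℕ} (hj : j ≤ h)
    (hy : IsNode y j) (s : Bool) (u : Fin h → Fin r ⊕ Bool) :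
    prefixLength (splice y j s u) = j := by
  refine le_antisymm (prefixLength_le fun k hk => ?_) ?_
  · have : y k ≠ none := fun h => absurd ((hy k).mp h) (not_lt.mpr hk)
    obtain ⟨a, ha⟩ := Option.ne_none_iff_exists'.mp this
    simp [splice, hk, ha]
  · by_contra! hlt
    have := isPlainFrom_prefixLength (splice y j s u) ⟨j - 1, by omega⟩
      (by simp only; omega)
    rw [splice, if_neg (by simp only; omega), if_pos (by simp only; omega)] at this
    simp at this

lemma trunc_splice {h r : ℕ} {y : Fin h → Option (Fin r)} {j : ℕ} (hy : IsNode y j) (s : Bool)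
    (u : Fin h → Fin r ⊕ Bool) : trunc (splice y j s u) j = y := by
  funext k
  unfold trunc
  split_ifs with hk
  · exact ((hy k).mpr hk).symm
  · have : y k ≠ none := fun h => absurd ((hy k).mp h) hk
    obtain ⟨a, ha⟩ := Option.ne_none_iff_exists'.mp this
    simp [splice, not_lt.mp hk, ha]

/-- A node of a higher level is the favourite of more words than there are words below a node of
lower level, because prefixes can be continued by either of two special letters. -/
lemma card_below_lt_card_favourite {h r i j : ℕ} {x y : Fin h → Option (Fin r)} (hij : i < j)
    (hj : j ≤ h) (hx : IsNode x i) (hy : IsNode y j) (P Q : Finset (Fin h → Fin r ⊕ Bool))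
    (hP : ∀ u ∈ P, trunc u i = x) (hQ : ∀ u, prefixLength u = j → trunc u j = y → u ∈ Q) :
    P.card < Q.card := by
  classical
  have hmem : ∀ s u, splice y j s u ∈ Q := fun s u =>
    hQ _ (prefixLength_splice hj hy s u) (trunc_splice hy s u)
  have hinj : Set.InjOn (splice y j false) P := by
    intro u hu u' hu' huu'
    funext k
    by_cases hk : (k : ℕ) < i
    · have := congrFun huu' k
      simpa [splice, show ¬ j ≤ (k : ℕ) by omega, show (k : ℕ) + 1 ≠ j by omega] using this
    · have hne : x k ≠ none := fun h => hk ((hx k).mp h)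
      obtain ⟨a, ha⟩ := Option.ne_none_iff_exists'.mp hne
      have hval : ∀ u ∈ P, u k = Sum.inl a := fun u hu => by
        have h1 := congrFun (hP u hu) k
        rw [trunc, if_neg hk, ha] at h1
        exact Sum.getLeft?_eq_some_iff.mp h1
      rw [hval u hu, hval u' hu']
  rw [← Finset.card_image_of_injOn hinj]
  refine Finset.card_lt_card ⟨?_, fun hsub => ?_⟩
  · intro u hu
    obtain ⟨u', _, rfl⟩ := Finset.mem_image.mp hu
    exact hmem _ _
  · obtain ⟨u, _, hu⟩ := Finset.mem_image.mp (hsub (hmem true fun _ => Sum.inr true))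
    have := congrFun hu ⟨j - 1, by omega⟩
    simp [splice, show ¬ j ≤ j - 1 by omega, show j - 1 + 1 = j by omega] at this

lemma exists_hierarchy {h r : ℕ} (hm : (r + 1) ^ h < m) :
    ∃ (H : Hierarchy h (Fin h → Fin r ⊕ Bool) m) (o : Fin m), H.level o = 0 ∧
      H.ty = prefixLength ∧ ∀ b c, H.level b < H.level c →
      (Finset.univ.filter fun v => 0 < H.level b ∧ H.ty v < H.level b ∧
        H.anc v (H.level b - 1) = b).card
      < (Finset.univ.filter fun v => H.anc v (H.ty v) = c).card := by
  classical
  have hcard : Fintype.card (Fin h → Option (Fin r)) < Fintype.card (Fin m) := by simpa using hm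
  obtain ⟨ι⟩ := Function.Embedding.nonempty_of_card_le hcard.le
  obtain ⟨o, ho⟩ : ∃ o, ∀ x, ι x ≠ o := by
    by_contra! hcon
    exact absurd (Fintype.card_le_of_surjective ι hcon) (not_le.mpr hcard)
  have hlev : ∀ c, ∃ l, l ≤ h + 1 ∧ (∀ i, l = i + 1 → ∃ x, ι x = c ∧ IsNode x i) ∧
      (l = 0 → ∀ x i, i ≤ h → IsNode x i → ι x ≠ c) := by
    intro c
    by_cases hex : ∃ x i, i ≤ h ∧ IsNode x i ∧ ι x = c
    · obtain ⟨x, i, hi, hx, rfl⟩ := hex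
      refine ⟨i + 1, by omega, fun i' hi' => ⟨x, rfl, ?_⟩, fun h => absurd h (by omega)⟩
      rwa [show i' = i by omega]
    · push Not at hex
      exact ⟨0, by omega, fun i hi => absurd hi (by omega), fun _ => hex⟩
  choose level hle hnode hzero using hlev
  have hlevel : ∀ x i, i ≤ h → IsNode x i → level (ι x) = i + 1 := by
    intro x i hi hx
    rcases Nat.eq_zero_or_eq_succ_pred (level (ι x)) with h0 | h0
    · exact absurd rfl (hzero _ h0 x i hi hx)
    · obtain ⟨x', hx', hn⟩ := hnode _ _ h0
      rw [ι.injective hx'] at hn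
      have := hle (ι x)
      rw [hn.eq_of_le hx (by omega) hi] at h0
      exact h0
  have htop : IsNode (fun _ : Fin h => (none : Option (Fin r))) h := fun k => by simp
  let H : Hierarchy h (Fin h → Fin r ⊕ Bool) m :=
    { level := level
      ty := prefixLength
      anc := fun u i => ι (trunc u i)
      w := ι fun _ => none
      level_le := hle
      ty_le := fun u => prefixLength_le fun k hk => absurd k.2 (not_lt.mpr hk)
      level_anc := fun u i hu hi => hlevel _ i hi (isNode_trunc hu)
      anc_top := fun u => by
        congr 1
        funext k
        simp [trunc]
      level_w := hlevel _ h le_rfl htop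
      eq_w := fun c hc => by
        obtain ⟨x, rfl, hx⟩ := hnode c h hc
        congr 1
        funext k
        exact (hx k).mpr k.2 }
  refine ⟨H, o, ?_, rfl, ?_⟩
  · by_contra hne
    obtain ⟨i, hi⟩ := Nat.exists_eq_succ_of_ne_zero hne
    obtain ⟨x, hx, _⟩ := hnode o i hi
    exact ho x hx
  · intro b c hbc
    change level b < level c at hbc
    obtain ⟨j, hj⟩ : ∃ j, level c = j + 1 := ⟨level c - 1, by omega⟩
    obtain ⟨y, rfl, hy⟩ := hnode c j hj
    have hjh : j ≤ h := by have := hle (ι y); omega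
    have hQ : ∀ u, prefixLength u = j → trunc u j = y →
        u ∈ Finset.univ.filter fun v => H.anc v (H.ty v) = ι y := by
      intro u hu huy
      refine Finset.mem_filter.mpr ⟨Finset.mem_univ _, ?_⟩
      change ι (trunc u (prefixLength u)) = ι y
      rw [hu, huy]
    rcases Nat.eq_zero_or_pos (level b) with h0 | h0
    · have hempty : (Finset.univ.filter fun v => 0 < H.level b ∧ H.ty v < H.level b ∧
          H.anc v (H.level b - 1) = b) = ∅ :=
        Finset.filter_eq_empty_iff.mpr fun v _ hv => absurd hv.1 (by change ¬ 0 < level b; omega)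
      rw [hempty, Finset.card_empty]
      exact Finset.card_pos.mpr ⟨_, hQ _ (prefixLength_splice hjh hy true fun _ => Sum.inr true)
        (trunc_splice hy _ _)⟩
    · obtain ⟨i, hi⟩ : ∃ i, level b = i + 1 := ⟨level b - 1, by omega⟩
      obtain ⟨x, rfl, hx⟩ := hnode b i hi
      refine card_below_lt_card_favourite (by omega) hjh hx hy _ _ (fun u hu => ?_) hQ
      have h1 := (Finset.mem_filter.mp hu).2.2.2
      change ι (trunc u (level (ι x) - 1)) = ι x at h1
      rw [hi, Nat.add_sub_cancel] at h1
      exact ι.injective h1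

/-- Most words have no special letter if there are many ordinary ones. -/
lemma sum_radius_le {h r : ℕ} (hr : r = 2 * h ^ 2) (H : Hierarchy h (Fin h → Fin r ⊕ Bool) m)
    (hty : H.ty = prefixLength) :
    ∑ v, (H.radius v : ℝ) ≤ 2 * Fintype.card (Fin h → Fin r ⊕ Bool) := by
  classical
  have hplain : r ^ h ≤ (Finset.univ.filter fun v => H.ty v = 0).card := by
    have h1 : Fintype.card (Fin h → Fin r) = r ^ h := by simp
    rw [← h1, ← Finset.card_univ]
    refine Finset.card_le_card_of_injOn (fun x k => Sum.inl (x k)) (fun x _ => ?_) ?_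
    · refine Finset.mem_coe.mpr (Finset.mem_filter.mpr ⟨Finset.mem_univ _, ?_⟩)
      rw [hty]
      exact Nat.le_zero.mp (prefixLength_le fun k _ => rfl)
    · intro x _ x' _ hxx'
      funext k
      exact Sum.inl_injective (congrFun hxx' k)
  have hsum : ∑ v, (H.radius v : ℝ) = ((h : ℝ) + 1) * Fintype.card (Fin h → Fin r ⊕ Bool)
      - h * (Finset.univ.filter fun v => H.ty v = 0).card := by
    have h1 : ∀ v, (H.radius v : ℝ) = ((h : ℝ) + 1) - h * (if H.ty v = 0 then 1 else 0) := by
      intro v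
      unfold Hierarchy.radius
      split_ifs <;> simp
    rw [Finset.sum_congr rfl fun v _ => h1 v, Finset.sum_sub_distrib, ← Finset.mul_sum,
      Finset.sum_boole, Finset.sum_const, Finset.card_univ, nsmul_eq_mul, mul_comm]
  have hcard : (Fintype.card (Fin h → Fin r ⊕ Bool) : ℝ) = ((r : ℝ) + 2) ^ h := by
    simp
  have hplain' : (r : ℝ) ^ h ≤ (Finset.univ.filter fun v => H.ty v = 0).card := by
    exact_mod_cast hplain
  have hr0 : (0 : ℝ) < (r : ℝ) + 2 := by positivity
  -- Bernoulli's inequality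
  have hbern : 1 - 2 * h / ((r : ℝ) + 2) ≤ (r / ((r : ℝ) + 2)) ^ h := by
    have h1 := one_add_mul_le_pow (a := -2 / ((r : ℝ) + 2)) (by
      rw [le_div_iff₀ hr0]; linarith [Nat.cast_nonneg (α := ℝ) r]) h
    have h2 : 1 + -2 / ((r : ℝ) + 2) = r / ((r : ℝ) + 2) := by field_simp; ring
    rw [h2] at h1
    have h3 : (h : ℝ) * (-2 / ((r : ℝ) + 2)) = - (2 * h / ((r : ℝ) + 2)) := by ring
    linarith
  rw [div_pow, le_div_iff₀ (by positivity)] at hbern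
  have hsmall : (h : ℝ) * (2 * h / ((r : ℝ) + 2)) ≤ 1 := by
    rw [mul_div_assoc', div_le_one hr0, hr]
    push_cast
    nlinarith
  rw [hsum, hcard]
  have hpow : (0 : ℝ) < ((r : ℝ) + 2) ^ h := by positivity
  have h1 := mul_le_mul_of_nonneg_left (hbern.trans hplain') (Nat.cast_nonneg (α := ℝ) h)
  have h2 := mul_le_mul_of_nonneg_right hsmall hpow.le
  linarith

lemma le_totalFairness_stv_of_pow_lt {h : ℕ} (hm : (2 * h ^ 2 + 1) ^ h < m)
    (f : ∀ N, Profile N m → Fin m) (hf : ∀ N σ, IsSTVWinner σ (f N σ)) :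
    ENNReal.ofReal ((h + 1) / 2) ≤ totalFairness f := by
  classical
  obtain ⟨H, o, ho, hty, hcount⟩ := exists_hierarchy hm
  choose τ hτ using fun v => exists_ranking (H.key v)
  let e := (Fintype.equivFin (Fin h → Fin (2 * h ^ 2) ⊕ Bool)).symm
  refine le_trans ?_ (fairness_le_totalFairness f fun v => τ (e v))
  rw [H.eq_w_of_isSTVWinner e hτ hcount (hf _ _)]
  exact H.le_fairness_w e hτ ⟨fun _ => Sum.inr true⟩ ho (sum_radius_le rfl H hty)

lemma le_totalFairness_stv (hm : 2 ≤ m) (f : ∀ N, Profile N m → Fin m)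
    (hf : ∀ N σ, IsSTVWinner σ (f N σ)) :
    ENNReal.ofReal (1 / 4 * √(Real.log m)) ≤ totalFairness f := by
  set L := Real.log m with hL
  have hm' : (2 : ℝ) ≤ m := by exact_mod_cast hm
  have hL0 : 0 < L := Real.log_pos (by linarith)
  set h := ⌊√L / 2⌋₊ with hh
  have h1 : (h : ℝ) ≤ √L / 2 := Nat.floor_le (by positivity)
  have h2 : √L / 2 < h + 1 := Nat.lt_floor_add_one _
  have hh0 : (0 : ℝ) ≤ h := Nat.cast_nonneg h
  have h3 : (2 * (h : ℝ) ^ 2 + 1) ^ h < m := by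
    have h4 : 2 * (h : ℝ) ^ 2 + 1 ≤ Real.exp (2 * h) := by
      have := Real.quadratic_le_exp_of_nonneg (x := 2 * h) (by positivity)
      nlinarith
    have h5 : (h : ℝ) ^ 2 ≤ L / 4 := by
      calc (h : ℝ) ^ 2 ≤ (√L / 2) ^ 2 := by gcongr
        _ = L / 4 := by rw [div_pow, Real.sq_sqrt hL0.le]; norm_num
    calc (2 * (h : ℝ) ^ 2 + 1) ^ h ≤ Real.exp (2 * h) ^ h := by gcongr
      _ = Real.exp (2 * (h : ℝ) ^ 2) := by rw [← Real.exp_nat_mul]; congr 1; ring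
      _ < Real.exp L := Real.exp_lt_exp.mpr (by linarith)
      _ = m := Real.exp_log (by linarith)
  refine le_trans (ENNReal.ofReal_le_ofReal ?_)
    (le_totalFairness_stv_of_pow_lt (h := h) (by exact_mod_cast h3) f hf)
  linarith

/-! ### Combining the bounds -/

lemma one_le_ruleFairness (hN : 1 ≤ N) (f : Profile N m → Fin m) : 1 ≤ ruleFairness f :=
  (one_le_fairness hN _ _).trans
    (le_iSup (fun σ => fairness (f σ) σ) fun _ => Equiv.refl _)

lemma half_mul_le_ruleFairness_approval {k : ℕ} (hN : 1 ≤ N) (hk : 1 ≤ k) (hkm : k < m)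
    (hk1 : k = 1 → N ≤ m) (f : Profile N m → Fin m)
    (hf : ∀ σ, IsScoringWinner (approvalVector k m) σ (f σ)) :
    ENNReal.ofReal (1 / 2 * N) ≤ ruleFairness f := by
  have hN' : (1 : ℝ) ≤ N := by exact_mod_cast hN
  rcases hk.lt_or_eq with hk | rfl
  · exact (ENNReal.ofReal_le_ofReal (by linarith)).trans (le_ruleFairness_approval hk hkm hN f hf)
  · rcases hN.lt_or_eq with hN2 | rfl
    · have : (2 : ℝ) ≤ N := by exact_mod_cast hN2
      refine (ENNReal.ofReal_le_ofReal (by linarith)).trans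
        (le_ruleFairness_plurality hkm hN2 ((hk1 rfl).trans (Nat.le_succ m)) f ?_)
      rwa [approvalVector_one] at hf
    · exact (ENNReal.ofReal_le_one.mpr (by norm_num)).trans (one_le_ruleFairness hN f)

lemma ruleFairness_le_of_undominated (hN : 1 ≤ N) {f : Profile N m → Fin m}
    (hf : ∀ σ, Undominated σ (f σ)) : ruleFairness f ≤ ENNReal.ofReal (3 * N) :=
  iSup_le fun σ => fairness_le_of_undominated hN (hf σ)

lemma totalFairness_harmonic_le (hm : 2 ≤ m) {f : ∀ N, Profile N m → Fin m}
    (hf : ∀ N σ, IsScoringWinner (harmonicVector m) σ (f N σ)) :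
    totalFairness f ≤ ENNReal.ofReal (1135 * (m / √(Real.log m))) := by
  have hm' : (2 : ℝ) ≤ m := by exact_mod_cast hm
  have hL0 : 0 < Real.log m := Real.log_pos (by linarith)
  have hL : Real.log m ≤ (m : ℝ) ^ 2 := by
    nlinarith [Real.log_le_sub_one_of_pos (x := m) (by linarith)]
  have h1 : 1 ≤ m / √(Real.log m) := by
    rw [one_le_div (Real.sqrt_pos.mpr hL0)]
    exact (Real.sqrt_le_left (by linarith)).mpr hL
  exact totalFairness_le fun N _ σ =>
    (fairness_le (by positivity) fun d hd o => harmonic_central hm (hf N σ) hd o).trans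
      (ENNReal.ofReal_le_ofReal (by linarith))

end SocialChoice

theorem mainTheorem5 :
    -- `k`-Approval
    (∃ a b : ℝ, 0 < a ∧ ∀ (k N m : ℕ), 1 ≤ N → ∀ f : Profile N m → Fin m,
      (∀ σ, IsScoringWinner (approvalVector k m) σ (f σ)) →
        (1 ≤ k → k < m → (k = 1 → N ≤ m) → ENNReal.ofReal (a * N) ≤ ruleFairness f) ∧
        ((∀ σ, Undominated σ (f σ)) → ruleFairness f ≤ ENNReal.ofReal (b * N))) ∧
    -- Veto
    (∃ a b : ℝ, 0 < a ∧ ∀ (N m : ℕ), 1 ≤ N → ∀ f : Profile N m → Fin m,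
      (∀ σ, IsScoringWinner (vetoVector m) σ (f σ)) →
        (3 ≤ m → ENNReal.ofReal (a * N) ≤ ruleFairness f) ∧
        ((∀ σ, Undominated σ (f σ)) → ruleFairness f ≤ ENNReal.ofReal (b * N))) ∧
    -- Plurality
    (∃ a b : ℝ, 0 < a ∧ ∀ m : ℕ, 1 ≤ m → ∀ f : ∀ N, Profile N m → Fin m,
      (∀ N σ, IsScoringWinner (pluralityVector m) σ (f N σ)) →
        ENNReal.ofReal (a * m) ≤ totalFairness f ∧
        totalFairness f ≤ ENNReal.ofReal (b * m)) ∧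
    -- Borda
    (∃ a b : ℝ, 0 < a ∧ ∀ m : ℕ, 1 ≤ m → ∀ f : ∀ N, Profile N m → Fin m,
      (∀ N σ, IsScoringWinner (bordaVector m) σ (f N σ)) →
        ENNReal.ofReal (a * m) ≤ totalFairness f ∧
        totalFairness f ≤ ENNReal.ofReal (b * m)) ∧
    -- the harmonic scoring rule
    (∃ a b : ℝ, 0 < a ∧ ∀ m : ℕ, 2 ≤ m → ∀ f : ∀ N, Profile N m → Fin m,
      (∀ N σ, IsScoringWinner (harmonicVector m) σ (f N σ)) →
        ENNReal.ofReal (a * (m / Real.log m)) ≤ totalFairness f ∧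
        totalFairness f ≤ ENNReal.ofReal (b * (m / Real.sqrt (Real.log m)))) ∧
    -- every scoring rule
    (∃ a : ℝ, 0 < a ∧ ∀ m : ℕ, 2 ≤ m → ∀ s : Fin m → ℝ, (∃ i j, s i ≠ s j) →
      ∀ f : ∀ N, Profile N m → Fin m, (∀ N σ, IsScoringWinner s σ (f N σ)) →
        ENNReal.ofReal (a * Real.sqrt (Real.log m)) ≤ totalFairness f) ∧
    -- STV
    (∃ a b : ℝ, 0 < a ∧ ∀ m : ℕ, 2 ≤ m → ∀ f : ∀ N, Profile N m → Fin m,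
      (∀ N σ, IsSTVWinner σ (f N σ)) →
        ENNReal.ofReal (a * Real.sqrt (Real.log m)) ≤ totalFairness f ∧
        totalFairness f ≤ ENNReal.ofReal (b * Real.log m)) := by
  refine ⟨⟨1 / 2, 3, by norm_num, fun k N m hN f hf => ⟨fun hk hkm hk1 =>
      half_mul_le_ruleFairness_approval hN hk hkm hk1 f hf, ruleFairness_le_of_undominated hN⟩⟩,
    ⟨1 / 2, 3, by norm_num, fun N m hN f hf => ⟨fun hm => ?_, ruleFairness_le_of_undominated hN⟩⟩,
    ⟨1 / 3, 3, by norm_num, fun m hm f hf => ⟨le_totalFairness_plurality f hf,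
      totalFairness_le fun N _ σ => fairness_plurality_le hm (hf N σ)⟩⟩,
    ⟨1 / 3, 3, by norm_num, fun m hm f hf => ⟨le_totalFairness_borda f hf,
      totalFairness_le fun N _ σ => fairness_borda_le hm (hf N σ)⟩⟩,
    ⟨1 / 6, 1135, by norm_num, fun m hm f hf => ⟨le_totalFairness_harmonic hm f hf,
      totalFairness_harmonic_le hm hf⟩⟩,
    ⟨1 / 2, by norm_num, fun m hm s hs f hf => le_totalFairness_scoring hm s hs f hf⟩,
    ⟨1 / 4, 974, by norm_num, fun m hm f hf => ⟨le_totalFairness_stv hm f hf,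
      totalFairness_le fun N hN σ => fairness_stv_le hm hN (hf N σ)⟩⟩⟩
  rw [vetoVector_eq_approvalVector] at hf
  exact half_mul_le_ruleFairness_approval hN (by omega) (by omega) (by omega) f hf
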